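/- Let $\Gamma=(I,E,m)$ be a simplicial graph with vertex set $I$, edge set $E$ and labels $m:E\to\mathbb N_{\ge 2}$, and write $m(i,j)=m(\{i,j\})$. Let $A_I$ be the Artin--Tits group generated by $\Sigma_I=\{\sigma_i\mid i\in I\}$ with the relations $\sigma_i\sigma_j\sigma_i\cdots=\sigma_j\sigma_i\sigma_j\cdots$ ($m(i,j)$ letters on each side) for $\{i,j\}\in E$, and let $W_I$ be the Coxeter group generated by $S_I=\{s_i\mid i\in I\}$ with the relations $s_i^2=1$ ($i\in I$) and $s_is_js_i\cdots=s_js_is_j\cdots$ ($m(i,j)$ letters on each side) for $\{i,j\}\in E$. Let $\theta_I:A_I\to W_I$, $\sigma_i\mapsto s_i$, let $CA_I=\ker\theta_I$ be the colored Artin--Tits group, let $A_I^+$ be the submonoid of $A_I$ generated by $\Sigma_I$, and let $\ell_I$ be the length on $W_I$ with respect to $S_I$, and also the length of words. For $X\subseteq I$ let $A_X,W_X,\Sigma_X,S_X,\theta_X,CA_X,A_X^+,\ell_X$ be the same objects for the full labelled subgraph spanned by $X$. Identify $W_X$ with its image in $W_I$, the subgroup generated by $S_X$. An element $w\in W_I$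 is $(X,\emptyset)$-reduced if it has minimal length in $W_Xw$. A bold letter $\boldsymbol\omega$ denotes the group element represented by the word $\omega$. For a word $\omega=\sigma_{i_1}^{\varepsilon_1}\cdots\sigma_{i_k}^{\varepsilon_k}$ on $\Sigma_I\cup\Sigma_I^{-1}$ let $r_j(\omega)=s_{i_1}\cdots s_{i_{j-1}}s_{i_j}s_{i_{j-1}}\cdots s_{i_1}\in W_I$ for $1\le j\le k$, and let $j_1<\dots<j_p$ be the indices $j$ with $r_j(\omega)\in W_X$. Then there is a unique word $s_{q_1}\cdots s_{q_p}$ on $S_X$ such that $s_{q_1}\cdots s_{q_{n-1}}s_{q_n}s_{q_{n-1}}\cdots s_{q_1}=r_{j_n}(\omega)$ in $W_I$ for $1\le n\le p$. Set $\pi^*_{I,X}(\omega)=\sigma_{q_1}^{\varepsilon_{j_1}}\cdots\sigma_{q_p}^{\varepsilon_{j_p}}$. For $X\subseteq Y\subseteq I$ the map $\pi^*_{Y,X}$ is defined in the same way from the subgraph spanned by $Y$. These maps have the following properties, for every $X\subseteq I$. 1. For every word $\omega$ on $\Sigma_I\cup\Sigma_I^{-1}$ one has $\ell_X(\pi^*_{I,X}(\omega))\le\ell_I(\omega)$,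 with equality if and only if $\omega$ is a word on $\Sigma_X\cup\Sigma_X^{-1}$; in the latter case $\pi^*_{I,X}(\omega)=\omega$. 2. For all words $\omega,\omega'$ on $\Sigma_I\cup\Sigma_I^{-1}$, $\pi^*_{I,X}(\omega)$ is a prefix of $\pi^*_{I,X}(\omega\omega')$. 3. $\pi^*_{I,X}$ induces a map $\pi_{I,X}:A_I\to A_X$. 4. For every $\boldsymbol\omega\in A_I$, with $v=\theta_X(\pi_{I,X}(\boldsymbol\omega))$, the element $v^{-1}\theta_I(\boldsymbol\omega)$ is $(X,\emptyset)$-reduced and $\ell_I(\theta_I(\boldsymbol\omega))=\ell_I(v)+\ell_I(v^{-1}\theta_I(\boldsymbol\omega))$. 5. $\pi_{I,X}$ restricts to a group homomorphism $CA_I\to CA_X$. 6. $\pi_{I,X}(A_I^+)=A_X^+$. 7. For every word $\omega$ on $\Sigma_X\cup\Sigma_X^{-1}$ and every $\boldsymbol\omega'\in A_I$, $\pi_{I,X}(\boldsymbol\omega\boldsymbol\omega')=\pi_{I,X}(\boldsymbol\omega)\,\pi_{I,X}(\boldsymbol\omega')$. 8. For every $\boldsymbol\omega\in CA_I$ and every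 $\boldsymbol\omega'\in A_I$, $\pi_{I,X}(\boldsymbol\omega\boldsymbol\omega')=\pi_{I,X}(\boldsymbol\omega)\,\pi_{I,X}(\boldsymbol\omega')$. 9. If $Y\subseteq I$ and $\omega$ is a word on $\Sigma_Y\cup\Sigma_Y^{-1}$, then $\pi^*_{I,X}(\omega)$ is a word on $\Sigma_{Y\cap X}\cup\Sigma_{Y\cap X}^{-1}$, and $\pi^*_{I,X}(\omega)=\pi^*_{Y,Y\cap X}(\omega)$. 10. For every $Y\subseteq I$ and every word $\omega$ on $\Sigma_I\cup\Sigma_I^{-1}$, $\pi^*_{I,Y}(\pi^*_{I,X}(\omega))=\pi^*_{I,X}(\pi^*_{I,Y}(\omega))=\pi^*_{I,X\cap Y}(\omega)$. 11. If $X\subseteq Y\subseteq I$ and $\omega$ is a word on $\Sigma_I\cup\Sigma_I^{-1}$, then $\pi^*_{Y,X}(\pi^*_{I,Y}(\omega))=\pi^*_{I,X}(\omega)$. -/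

import Mathlib

namespace ArtinTits

/-! A Coxeter matrix `M` on `I` encodes the labelled graph on `I` having an edge `{i, j}`, with
label `M i j ≥ 2`, whenever `i ≠ j` and `M i j ≠ 0`; the entry `M i j = 0` means that there is no
edge. The Coxeter group `W_I` is `M.Group`. -/

/-- The full labelled subgraph spanned by a subset `X` of the vertices. -/
def restrict {I : Type*} (M : CoxeterMatrix I) (X : Set I) : CoxeterMatrix X where
  M := fun i j => M i j
  isSymm := Matrix.IsSymm.ext fun i j => M.symmetric j i
  diagonal i := M.diagonal i
  off_diagonal i j h := M.off_diagonal i j fun h' => h (Subtype.ext h')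

/-! ### Artin-Tits groups -/

/-- The braid relators `(⋯ σ_i σ_j)(⋯ σ_j σ_i)⁻¹`, each alternating word having `M i j` letters.
They are trivial if `i = j` or if there is no edge between `i` and `j`. -/
def braidRelators {I : Type*} (M : CoxeterMatrix I) : Set (FreeGroup I) :=
  Set.range fun p : I × I =>
    ((CoxeterSystem.braidWord M p.1 p.2).map FreeGroup.of).prod *
      (((CoxeterSystem.braidWord M p.2 p.1).map FreeGroup.of).prod)⁻¹

/-- The Artin-Tits group `A_I`, given by its presentation. -/
abbrev ArtinGroup {I : Type*} (M : CoxeterMatrix I) : Type _ := PresentedGroup (braidRelators M)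

/-- The generator `σ_i` of the Artin-Tits group. -/
def artinGen {I : Type*} (M : CoxeterMatrix I) (i : I) : ArtinGroup M := PresentedGroup.of i

/-- A word on the letters `σ_i` and `σ_i⁻¹`, `i ∈ I`: the letter `σ_i` is `(i, true)` and the
letter `σ_i⁻¹` is `(i, false)`. -/
abbrev SignedWord (I : Type*) : Type _ := List (I × Bool)

/-- The element of the Artin-Tits group represented by a word. -/
def wordElt {I : Type*} (M : CoxeterMatrix I) (ω : SignedWord I) : ArtinGroup M :=
  PresentedGroup.mk (braidRelators M) (FreeGroup.mk ω)

theorem braidRelators_map {I : Type*} (M : CoxeterMatrix I) :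
    ∀ r ∈ braidRelators M, FreeGroup.lift M.simple r = 1 := by
  rintro _ ⟨⟨i, j⟩, rfl⟩
  have key : ∀ l : List I, FreeGroup.lift M.simple (l.map FreeGroup.of).prod =
      M.toCoxeterSystem.wordProd l := by
    intro l
    induction l with
    | nil => simp
    | cons a l ih => simp [CoxeterSystem.wordProd_cons, ih]
  rw [map_mul, map_inv, key, key, M.toCoxeterSystem.wordProd_braidWord_eq i j, mul_inv_cancel]

/-- The morphism `θ_I : A_I → W_I` sending `σ_i` to `s_i`. -/
def theta {I : Type*} (M : CoxeterMatrix I) : ArtinGroup M →* M.Group :=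
  PresentedGroup.toGroup (braidRelators_map M)

/-- The colored Artin-Tits group `CA_I`. -/
def coloredArtin {I : Type*} (M : CoxeterMatrix I) : Subgroup (ArtinGroup M) := (theta M).ker

/-- The submonoid `A_I⁺` of `A_I` generated by the `σ_i`. -/
def positiveMonoid {I : Type*} (M : CoxeterMatrix I) : Submonoid (ArtinGroup M) :=
  Submonoid.closure (Set.range (artinGen M))

/-- A word on `Σ_X ∪ Σ_X⁻¹`, viewed as a word on `Σ_I ∪ Σ_I⁻¹`. -/
def inclWord {I : Type*} {X : Set I} (ω : SignedWord X) : SignedWord I :=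
  ω.map fun a => ((a.1 : I), a.2)

/-- The word `ω` only uses letters of `Σ_X ∪ Σ_X⁻¹`. -/
def IsWordOn {I : Type*} (X : Set I) (ω : SignedWord I) : Prop := ∀ a ∈ ω, a.1 ∈ X

/-! ### Parabolic subgroups of the Coxeter group -/

/-- The length `ℓ_I` on `W_I`. -/
noncomputable def coxLength {I : Type*} (M : CoxeterMatrix I) (w : M.Group) : ℕ :=
  M.toCoxeterSystem.length w

/-- The morphism `τ_X : W_X → W_I` sending `s_i` to `s_i`, where `W_X` is the Coxeter group of the
subgraph spanned by `X`. -/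
def tau {I : Type*} (M : CoxeterMatrix I) (X : Set I) : (restrict M X).Group →* M.Group :=
  (restrict M X).toCoxeterSystem.lift
    ⟨fun i => M.simple i, fun i j => M.toCoxeterSystem.simple_mul_simple_pow (i : I) (j : I)⟩

/-- The standard parabolic subgroup of `W_I` generated by the `s_i`, `i ∈ X`, that is, the image
of `W_X` in `W_I`. -/
def parabolic {I : Type*} (M : CoxeterMatrix I) (X : Set I) : Subgroup M.Group :=
  Subgroup.closure (M.simple '' X)

theorem range_tau {I : Type*} (M : CoxeterMatrix I) (X : Set I) :
    (tau M X).range = parabolic M X := by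
  have h : ∀ i : X, tau M X ((restrict M X).toCoxeterSystem.simple i) = M.simple i := fun i =>
    CoxeterSystem.lift_apply_simple _ _ i
  rw [MonoidHom.range_eq_map, ← (restrict M X).toCoxeterSystem.subgroup_closure_range_simple,
    MonoidHom.map_closure, parabolic, ← Set.range_comp]
  congr 1
  ext w
  constructor
  · rintro ⟨i, rfl⟩
    exact ⟨i, i.2, (h i).symm⟩
  · rintro ⟨i, hi, rfl⟩
    exact ⟨⟨i, hi⟩, h ⟨i, hi⟩⟩

/-- `w` is `(X, Y)`-reduced: it has minimal length in its double coset `W_X w W_Y`. -/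
def IsDoubleReduced {I : Type*} (M : CoxeterMatrix I) (X Y : Set I) (w : M.Group) : Prop :=
  ∀ w' ∈ DoubleCoset.doubleCoset w (parabolic M X : Set M.Group) (parabolic M Y : Set M.Group),
    coxLength M w ≤ coxLength M w'

/-! ### The retraction on words -/

/-- For `ω = σ_{i₁}^{ε₁} ⋯ σ_{iₖ}^{εₖ}`, the sequence of the pairs `(r_j, ε_j)`, where `r_j` is the
reflection `s_{i₁} ⋯ s_{i_{j-1}} s_{i_j} s_{i_{j-1}} ⋯ s_{i₁}`. -/
def signedReflections {I : Type*} (M : CoxeterMatrix I) (ω : SignedWord I) :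
    List (M.Group × Bool) :=
  (M.toCoxeterSystem.leftInvSeq (ω.map Prod.fst)).zip (ω.map Prod.snd)

open scoped Classical in
/-- The word `ω'` on `Σ_X ∪ Σ_X⁻¹` is obtained from `ω` by keeping the letters whose reflection
`r_j` lies in `W_X`, with their exponents, and relabelling them so that the sequence of the
reflections of `ω'` is the sequence of those reflections `r_j` that lie in `W_X`. -/
def IsRetractedWord {I : Type*} (M : CoxeterMatrix I) (X : Set I) (ω : SignedWord I)
    (ω' : SignedWord X) : Prop :=
  signedReflections M (inclWord ω') =
    (signedReflections M ω).filter fun p => p.1 ∈ parabolic M X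

/-- The map `π*_{I,X}`: the word `π*_{I,X}(ω)` is the one characterised by `IsRetractedWord`. -/
noncomputable def piStar {I : Type*} (M : CoxeterMatrix I) (X : Set I) (ω : SignedWord I) :
    SignedWord X :=
  Classical.epsilon fun ω' => IsRetractedWord M X ω ω'

/-- The map `π*_{Y,X}` for `X ⊆ Y ⊆ I`: it is the map `π*` of the subgraph spanned by `Y` and its
subset `X`. -/
noncomputable def piStarRel {I : Type*} (M : CoxeterMatrix I) {X Y : Set I} (_h : X ⊆ Y)
    (ω : SignedWord Y) : SignedWord X :=
  (piStar (restrict M Y) {y : Y | (y : I) ∈ X} ω).map fun a => (⟨(a.1.1 : I), a.1.2⟩, a.2)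

end ArtinTits

/-!
The argument runs through minimal coset representatives. Let `v` be the element of minimal length of
a coset `W_X w`. Deodhar's lemma (`IsMinimal.mul_simple`) says that `v s_i` is either again minimal
in its coset or equal to `s_q v` for some `q ∈ X`; the second case occurs exactly when the reflection
`v s_i v⁻¹` lies in `W_X` (`letter_isSome_iff`). So a word can be read from left to right while
keeping track of the coset of the prefix read so far: the letter `σ_i` becomes `σ_q` in the second
case and is dropped in the first. This is `retract`, and `signedReflections_retract` shows that the
word produced has the required reflections. As the sequence of reflections determines the word,
`retract` is `π*`, and the compatibilities of the maps `π*` reduce to identities between filters of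
lists of reflections, using `W_X ∩ W_Y = W_{X ∩ Y}`.

The substance is invariance under braid relations (`letters_braidWord`). Let `z` be minimal in
`W_X w W_{i,j}`. Comparing lengths, any letter `q` kept while reading a word on `i, j` from `w`
satisfies `z s_l = s_q z` for some `l ∈ {i, j}`. If both `i` and `j` arise as such an `l`, the double
coset is one coset, reading is a relabelling `i ↦ a, j ↦ b`, and `m(a, b) = m(i, j)` because
`s_a s_b` and `s_i s_j` are conjugate. Otherwise all letters kept are equal, and there are as many of
them for both sides, since both sides of a braid relation have the same reflections.

Recording the letter for all starting cosets at once gives homomorphisms into the wreath product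
`(W_I → G) ⋊ W_I`. For `G = A_X` this is a homomorphism on `A_I` (`artinWreath`) whose component at
the trivial coset is `π`; its cocycle rule `π(ab) = π(a) · (component of b at θ(a))` gives the
multiplicativity statements. For `G = W_X` it is a homomorphism on `W_I` which splits `W_X → W_I`,
whence the injectivity of `tau`.

Two classical facts about Coxeter groups are proved on the way: that `s_i s_j` has order `m(i, j)`,
from the geometric representation (`dvd_of_pow_eq_one`), and the exchange condition
(`exists_eraseIdx_of_isLeftDescent`).
-/

namespace CoxeterSystem

open Polynomial.Chebyshev

variable {B W : Type*} [Group W] {M : CoxeterMatrix B} (cs : CoxeterSystem M W)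

/-! ### The geometric representation and the order of `s_i s_j` -/

/-- The linear form `2 B(e_i, -)` of the geometric representation on `B →₀ ℝ`, whose value at `e_j`
is `-2 cos (π / m(i, j))`. For `m(i, j) = 0`, which stands for `∞`, the convention `π / 0 = 0` makes
this the usual value `-2`. -/
noncomputable def rootForm (M : CoxeterMatrix B) (i : B) : Module.Dual ℝ (B →₀ ℝ) :=
  Finsupp.linearCombination ℝ fun j => -2 * Real.cos (Real.pi / M i j)

theorem rootForm_single (M : CoxeterMatrix B) (i j : B) :
    rootForm M i (Finsupp.single j 1) = -2 * Real.cos (Real.pi / M i j) := by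
  simp [rootForm]

theorem rootForm_self (M : CoxeterMatrix B) (i : B) :
    rootForm M i (Finsupp.single i 1) = 2 := by
  simp [rootForm_single]

/-- The reflection by which `s_i` acts in the geometric representation. -/
noncomputable def rootReflection (M : CoxeterMatrix B) (i : B) : (B →₀ ℝ) ≃ₗ[ℝ] (B →₀ ℝ) :=
  Module.reflection (rootForm_self M i)

theorem rootForm_mul_sub_two (M : CoxeterMatrix B) (i j : B) :
    2 * Real.cos (2 * Real.pi / M i j) =
      rootForm M i (Finsupp.single j 1) * rootForm M j (Finsupp.single i 1) - 2 := by
  rw [rootForm_single, rootForm_single, M.symmetric j i, mul_div_assoc, Real.cos_two_mul]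
  ring

theorem sin_two_pi_div_pos {m : ℕ} (hm : 2 < m) : 0 < Real.sin (2 * Real.pi / m) := by
  have hm' : (2 : ℝ) < m := by exact_mod_cast hm
  apply Real.sin_pos_of_pos_of_lt_pi
  · have := Real.pi_pos
    positivity
  · rw [div_lt_iff₀ (by linarith)]
    nlinarith [Real.pi_pos]

/-- The two Chebyshev coefficients in the formula for `(r_i r_j) ^ m` vanish at
`2 cos (2π / m)`. -/
theorem chebyshev_coefficients_eq_zero {m : ℕ} (hm : 2 < m) :
    (S ℝ ((m - 2) / 2)).eval (2 * Real.cos (2 * Real.pi / m)) *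
        ((S ℝ ((m - 1) / 2)).eval (2 * Real.cos (2 * Real.pi / m)) +
          (S ℝ ((m - 3) / 2)).eval (2 * Real.cos (2 * Real.pi / m))) = 0 ∧
      (S ℝ ((m - 1) / 2)).eval (2 * Real.cos (2 * Real.pi / m)) *
        ((S ℝ (m / 2)).eval (2 * Real.cos (2 * Real.pi / m)) +
          (S ℝ ((m - 2) / 2)).eval (2 * Real.cos (2 * Real.pi / m))) = 0 := by
  have hs := (sin_two_pi_div_pos hm).ne'
  have hm0 : (m : ℝ) ≠ 0 := by positivity
  set θ := 2 * Real.pi / m with hθ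
  have hmθ : m * θ = 2 * Real.pi := by rw [hθ]; field_simp
  rcases Nat.even_or_odd' m with ⟨p, hp | hp⟩
  · have h1 : ((m : ℤ) - 2) / 2 = p - 1 := by omega
    have h2 : ((m : ℤ) - 1) / 2 = p - 1 := by omega
    have h0 : (S ℝ ((p : ℤ) - 1)).eval (2 * Real.cos θ) = 0 := by
      have h := S_two_mul_real_cos θ ((p : ℤ) - 1)
      have hpi : (((p : ℤ) - 1 : ℤ) + 1 : ℝ) * θ = Real.pi := by
        rw [hp] at hmθ
        push_cast at hmθ ⊢
        linarith
      rw [hpi, Real.sin_pi] at h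
      exact (mul_eq_zero.mp h).resolve_right hs
    rw [h1, h2, h0]
    simp
  · have h1 : ((m : ℤ) - 2) / 2 = p - 1 := by omega
    have h2 : ((m : ℤ) - 1) / 2 = p := by omega
    have h3 : ((m : ℤ) - 3) / 2 = p - 1 := by omega
    have h4 : (m : ℤ) / 2 = p := by omega
    have h0 : (S ℝ (p : ℤ)).eval (2 * Real.cos θ) +
        (S ℝ ((p : ℤ) - 1)).eval (2 * Real.cos θ) = 0 := by
      have h := S_two_mul_real_cos θ (p : ℤ)
      have h' := S_two_mul_real_cos θ ((p : ℤ) - 1)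
      have hpi : (((p : ℤ) : ℝ) + 1) * θ =
          2 * Real.pi - (((p : ℤ) - 1 : ℤ) + 1 : ℝ) * θ := by
        rw [hp] at hmθ
        push_cast at hmθ ⊢
        linarith
      rw [hpi, Real.sin_two_pi_sub] at h
      refine (mul_eq_zero.mp ?_).resolve_right hs
      rw [add_mul, h, h', neg_add_cancel]
    rw [h1, h2, h3, h4, h0]
    simp

theorem rootReflection_isLiftable (M : CoxeterMatrix B) : M.IsLiftable (rootReflection M) := by
  intro i j
  by_cases hij : i = j
  · subst hij
    rw [M.diagonal, pow_one]
    ext1 z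
    exact Module.involutive_reflection (rootForm_self M i) z
  have h1 : M i j ≠ 1 := M.off_diagonal i j hij
  rcases lt_or_ge 2 (M i j) with h2 | h2
  · ext1 z
    have h := Module.reflection_mul_reflection_pow_apply (rootForm_self M i) (rootForm_self M j)
      (M i j) z _ (rootForm_mul_sub_two M i j)
    obtain ⟨c1, c2⟩ := chebyshev_coefficients_eq_zero h2
    rw [c1, c2] at h
    simpa [rootReflection] using h
  · obtain h0 | h0 : M i j = 0 ∨ M i j = 2 := by omega
    · rw [h0, pow_zero]
    · ext1 z
      have e1 : rootForm M i (Finsupp.single j 1) = 0 := by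
        simp [rootForm_single, h0]
      have e2 : rootForm M j (Finsupp.single i 1) = 0 := by
        simp [rootForm_single, M.symmetric j i, h0]
      have f1 := rootForm_self M i
      have f2 := rootForm_self M j
      simp only [rootReflection, h0, pow_two, LinearEquiv.mul_apply, Module.reflection_apply,
        map_sub, map_smul, e1, e2, f1, f2, LinearEquiv.coe_one, id_eq]
      module

theorem dvd_of_pow_eq_one {i j : B} {k : ℕ} (h : (cs.simple i * cs.simple j) ^ k = 1) :
    M i j ∣ k := by
  by_cases hij : i = j
  · subst hij
    simp
  classical
  have hk := congrArg (cs.lift ⟨_, rootReflection_isLiftable M⟩) h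
  rw [map_pow, map_mul, lift_apply_simple, lift_apply_simple, map_one] at hk
  have h1 : M i j ≠ 1 := M.off_diagonal i j hij
  have happ := Module.reflection_mul_reflection_pow_apply_self (rootForm_self M i)
    (rootForm_self M j) k _ (rootForm_mul_sub_two M i j)
  change ((rootReflection M i * rootReflection M j) ^ k) _ = _ at happ
  rw [hk] at happ
  have ci := congrArg (fun f : B →₀ ℝ => f i) happ
  have cj := congrArg (fun f : B →₀ ℝ => f j) happ
  simp only [LinearEquiv.coe_one, id_eq, Finsupp.single_apply, Finsupp.add_apply,
    Finsupp.smul_apply, smul_eq_mul, if_neg hij, if_neg (Ne.symm hij), if_true, mul_one, mul_zero,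
    add_zero, zero_add, rootForm_single, M.symmetric j i] at ci cj
  by_cases h2 : M i j = 2
  · rw [h2] at ci ⊢
    have ht : 2 * Real.cos (2 * Real.pi / (2 : ℕ)) = -2 := by
      rw [Nat.cast_ofNat, mul_div_cancel_left₀ _ (two_ne_zero), Real.cos_pi]
      norm_num
    rw [ht, S_eval_neg_two, S_eval_neg_two] at ci
    rcases Nat.even_or_odd k with hk2 | hk2
    · exact hk2.two_dvd
    · exfalso
      have o1 : Odd (k : ℤ) := by exact_mod_cast hk2
      have o2 : Even ((k : ℤ) - 1) := o1.sub_odd odd_one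
      rw [Int.negOnePow_odd _ o1, Int.negOnePow_even _ o2] at ci
      push_cast at ci
      linarith
  have hcos : Real.cos (Real.pi / M i j) ≠ 0 := by
    rcases Nat.eq_zero_or_pos (M i j) with h0 | h0
    · simp [h0]
    · have h3 : (3 : ℝ) ≤ M i j := by
        have : 3 ≤ M i j := by omega
        exact_mod_cast this
      apply ne_of_gt
      apply Real.cos_pos_of_mem_Ioo
      constructor
      · have : 0 < Real.pi / M i j := by
          have := Real.pi_pos
          positivity
        linarith [Real.pi_pos]
      · rw [div_lt_div_iff₀ (by linarith) two_pos]
        nlinarith [Real.pi_pos]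
  have hS : (S ℝ ((k : ℤ) - 1)).eval (2 * Real.cos (2 * Real.pi / M i j)) = 0 := by
    rcases mul_eq_zero.mp cj.symm with h | h
    · exact h
    · exact absurd (by linarith) hcos
  rw [hS, add_zero] at ci
  rcases Nat.eq_zero_or_pos (M i j) with h0 | h0
  · rw [h0, Nat.cast_zero, div_zero, Real.cos_zero, mul_one, S_eval_two] at hS
    rw [h0, zero_dvd_iff]
    push_cast at hS
    exact_mod_cast (by linarith : (k : ℝ) = 0)
  · have hm : 2 < M i j := by omega
    have hs := (sin_two_pi_div_pos hm).ne'
    set θ := 2 * Real.pi / M i j with hθ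
    have s1 := S_two_mul_real_cos θ ((k : ℤ) - 1)
    have s2 := S_two_mul_real_cos θ (k : ℤ)
    rw [hS, zero_mul] at s1
    push_cast at s1 s2
    rw [sub_add_cancel] at s1
    rw [← ci, add_mul, Real.sin_add, ← s1, one_mul, one_mul, zero_mul, zero_add] at s2
    have hc : Real.cos (k * θ) = 1 := (mul_eq_right₀ hs).mp s2.symm
    obtain ⟨n, hn⟩ := (Real.cos_eq_one_iff _).mp hc
    have hmR : (M i j : ℝ) ≠ 0 := by positivity
    rw [hθ] at hn
    field_simp at hn
    have hz : (k : ℤ) = M i j * n := by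
      have : (k : ℝ) = M i j * n := by linarith
      exact_mod_cast this
    exact Int.natCast_dvd_natCast.mp ⟨n, hz⟩

theorem simple_injective : Function.Injective cs.simple := by
  intro i j h
  by_contra hij
  refine M.off_diagonal i j hij (Nat.dvd_one.mp (cs.dvd_of_pow_eq_one (k := 1) ?_))
  rw [h, pow_one, simple_mul_simple_self]

/-! ### The exchange condition -/

open scoped Classical in
/-- The action of `s_i` on `W × ZMod 2` by `(t, ε) ↦ (s_i t s_i, ε + [t = s_i])`. -/
noncomputable def parityMap (i : B) : Function.End (W × ZMod 2) := fun p =>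
  (cs.simple i * p.1 * cs.simple i, p.2 + if p.1 = cs.simple i then 1 else 0)

theorem end_mul_apply {α : Type*} (f g : Function.End α) (a : α) : (f * g) a = f (g a) := rfl

open scoped Classical in
theorem parityMap_mul_pow_apply (i j : B) (k : ℕ) (t : W) (ε : ZMod 2) :
    ((cs.parityMap i * cs.parityMap j) ^ k) (t, ε) =
      ((cs.simple i * cs.simple j) ^ k * t * ((cs.simple i * cs.simple j) ^ k)⁻¹,
        ε + ∑ n ∈ Finset.range (2 * k),
          if t = cs.simple j * (cs.simple i * cs.simple j) ^ n then 1 else 0) := by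
  set x := cs.simple i * cs.simple j with hx
  have hxj : ∀ n : ℕ, (x ^ n)⁻¹ * cs.simple j = cs.simple j * x ^ n := by
    intro n
    have hinv : x⁻¹ = cs.simple j * x * (cs.simple j)⁻¹ := by simp [hx, mul_assoc]
    rw [← inv_pow, hinv, conj_pow]
    simp
  have hji : cs.simple j * cs.simple i * cs.simple j = cs.simple j * x := by
    rw [hx, mul_assoc]
  induction k with
  | zero => simp [Function.End.one_def]
  | succ k ih =>
    rw [pow_succ', end_mul_apply, ih, end_mul_apply, parityMap, parityMap]
    have e1 : x ^ k * t * (x ^ k)⁻¹ = cs.simple j ↔ t = cs.simple j * x ^ (2 * k) := by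
      rw [mul_inv_eq_iff_eq_mul, ← eq_inv_mul_iff_mul_eq, ← mul_assoc, hxj, mul_assoc, two_mul,
        pow_add]
    have e2 : cs.simple j * (x ^ k * t * (x ^ k)⁻¹) * cs.simple j = cs.simple i ↔
        t = cs.simple j * x ^ (2 * k + 1) := by
      rw [← mul_right_cancel_iff (a := cs.simple j), simple_mul_simple_cancel_right,
        ← mul_right_inj (cs.simple j), simple_mul_simple_cancel_left, ← mul_assoc, hji,
        mul_inv_eq_iff_eq_mul, ← eq_inv_mul_iff_mul_eq, ← mul_assoc, ← mul_assoc, hxj]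
      rw [mul_assoc, mul_assoc, ← pow_succ', ← pow_add, show k + (k + 1) = 2 * k + 1 by omega]
    simp only [e1, e2]
    rw [Nat.mul_succ, Finset.sum_range_succ, Finset.sum_range_succ]
    refine Prod.ext ?_ ?_
    · simp only [pow_succ' x k, mul_inv_rev]
      simp [hx, mul_assoc]
    · simp only [add_assoc]

theorem parityMap_isLiftable : M.IsLiftable cs.parityMap := by
  classical
  intro i j
  funext ⟨t, ε⟩
  rw [parityMap_mul_pow_apply, simple_mul_simple_pow, two_mul, Finset.sum_range_add]
  simp only [pow_add, simple_mul_simple_pow, one_mul]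
  rw [CharTwo.add_self_eq_zero]
  simp [Function.End.one_def]

open scoped Classical in
theorem lift_parityMap_wordProd (ω : List B) (t : W) :
    cs.lift ⟨_, cs.parityMap_isLiftable⟩ (cs.wordProd ω) (t, 0) =
      (cs.wordProd ω * t * (cs.wordProd ω)⁻¹, ((cs.rightInvSeq ω).count t : ZMod 2)) := by
  induction ω with
  | nil => simp [Function.End.one_def]
  | cons i ω ih =>
    rw [wordProd_cons, map_mul, end_mul_apply, ih, lift_apply_simple,
      parityMap, rightInvSeq, List.count_cons]
    refine Prod.ext (by simp [mul_assoc]) ?_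
    have e : cs.wordProd ω * t * (cs.wordProd ω)⁻¹ = cs.simple i ↔
        (cs.wordProd ω)⁻¹ * cs.simple i * cs.wordProd ω = t := by
      constructor <;> rintro h
      · rw [← h]; group
      · rw [← h]; group
    simp [e]

/-- The exchange condition: the parity of the number of occurrences of `s_i` in the right inversion
sequence only depends on the element, and it is odd for a reduced word ending with `i`. -/
theorem simple_mem_rightInvSeq {ω : List B} {i : B} (h : cs.IsRightDescent (cs.wordProd ω) i) :
    cs.simple i ∈ cs.rightInvSeq ω := by
  classical
  obtain ⟨ω', hω', hprod⟩ := cs.exists_isReduced (cs.wordProd ω * cs.simple i)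
  have hprod' : cs.wordProd (ω'.concat i) = cs.wordProd ω := by
    rw [wordProd_concat, ← hprod, simple_mul_simple_cancel_right]
  have hred : cs.IsReduced (ω'.concat i) := by
    rw [IsReduced, hprod', ← cs.isRightDescent_iff.mp h, hprod, hω'.eq]
    simp
  have hcount : (cs.rightInvSeq (ω'.concat i)).count (cs.simple i) = 1 := by
    apply List.count_eq_one_of_mem hred.nodup_rightInvSeq
    rw [rightInvSeq_concat]
    simp
  have h1 := cs.lift_parityMap_wordProd ω (cs.simple i)
  have h2 := cs.lift_parityMap_wordProd (ω'.concat i) (cs.simple i)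
  rw [hprod', h1, hcount] at h2
  by_contra hmem
  rw [List.count_eq_zero_of_not_mem hmem] at h2
  simpa using congrArg Prod.snd h2

theorem simple_mem_leftInvSeq {ω : List B} {i : B} (h : cs.IsLeftDescent (cs.wordProd ω) i) :
    cs.simple i ∈ cs.leftInvSeq ω := by
  rw [← cs.isRightDescent_inv_iff, ← wordProd_reverse] at h
  have := cs.simple_mem_rightInvSeq h
  rwa [rightInvSeq_reverse, List.mem_reverse] at this

theorem exists_eraseIdx_of_isLeftDescent {ω : List B} {i : B}
    (h : cs.IsLeftDescent (cs.wordProd ω) i) :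
    ∃ k < ω.length, cs.simple i * cs.wordProd ω = cs.wordProd (ω.eraseIdx k) := by
  obtain ⟨k, hk, he⟩ := List.mem_iff_getElem.mp (cs.simple_mem_leftInvSeq h)
  refine ⟨k, by simpa using hk, ?_⟩
  rw [← he, ← List.getD_eq_getElem _ 1 hk, getD_leftInvSeq_mul_wordProd]

/-- The initial segment of length `m(i, j)` of `i j i j ⋯` has the reflections of that of
`j i j i ⋯`, in the reverse order. -/
theorem leftInvSeq_take_alternatingWord (i j : B) :
    cs.leftInvSeq ((alternatingWord i j (2 * M i j)).take (M i j)) =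
      (cs.leftInvSeq ((alternatingWord j i (2 * M i j)).take (M i j))).reverse := by
  rw [leftInvSeq_take, leftInvSeq_take]
  apply List.ext_getElem
  · simp
  intro k hk hk'
  have hlt : k < M i j := by
    simp only [List.length_take, length_leftInvSeq, length_alternatingWord] at hk
    omega
  have hlen : (List.take (M i j) (cs.leftInvSeq (alternatingWord j i (2 * M i j)))).length =
      M i j := by
    simp only [List.length_take, length_leftInvSeq, length_alternatingWord]
    omega
  rw [List.getElem_take, List.getElem_reverse, List.getElem_take,
    getElem_leftInvSeq_alternatingWord _ _ _ _ _ (by omega),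
    getElem_leftInvSeq_alternatingWord _ _ _ _ _ (by omega),
    prod_alternatingWord_eq_prod_alternatingWord_sub _ _ _ _ (by rw [M.symmetric]; omega)]
  congr 2
  rw [M.symmetric j i, hlen]
  omega

theorem take_alternatingWord (i j : B) (m : ℕ) (hm : 0 < m) :
    (alternatingWord i j (2 * m)).take m =
      if Even m then alternatingWord i j m else alternatingWord j i m :=
  listTake_alternatingWord i j m m (by omega)

theorem leftInvSeq_braidWord_perm (i j : B) :
    (cs.leftInvSeq (braidWord M i j)).Perm (cs.leftInvSeq (braidWord M j i)) := by
  rcases Nat.eq_zero_or_pos (M i j) with h0 | h0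
  · rw [braidWord, braidWord, M.symmetric j i, h0, alternatingWord, alternatingWord]
  have h := cs.leftInvSeq_take_alternatingWord i j
  rw [take_alternatingWord _ _ _ h0, take_alternatingWord _ _ _ h0] at h
  rw [braidWord, braidWord, M.symmetric j i]
  split_ifs at h
  · rw [h]
    exact List.reverse_perm _
  · rw [h]
    exact (List.reverse_perm _).symm

end CoxeterSystem

namespace ArtinTits

open CoxeterSystem

variable {I : Type*} (M : CoxeterMatrix I) (X : Set I)

/-! ### Standard parabolic subgroups -/

theorem wordProd_mem_parabolic {ω : List I} (hω : ∀ i ∈ ω, i ∈ X) :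
    M.toCoxeterSystem.wordProd ω ∈ parabolic M X := by
  induction ω with
  | nil => simp
  | cons i ω ih =>
    rw [wordProd_cons]
    exact mul_mem (Subgroup.subset_closure ⟨i, hω i (by simp), rfl⟩)
      (ih fun j hj => hω j (by simp [hj]))

/-- A word with letters in `X` is equivalent to a reduced one: each letter either lengthens the
reduced word of what follows it, or cancels one of its letters. -/
theorem exists_isReduced_of_word {ω : List I} (hω : ∀ i ∈ ω, i ∈ X) :
    ∃ ω' : List I, (∀ i ∈ ω', i ∈ X) ∧ M.toCoxeterSystem.IsReduced ω' ∧
      M.toCoxeterSystem.wordProd ω' = M.toCoxeterSystem.wordProd ω := by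
  induction ω with
  | nil => exact ⟨[], by simp, by simp [CoxeterSystem.IsReduced], rfl⟩
  | cons i ω ih =>
    obtain ⟨ω', hX, hred, hprod⟩ := ih fun j hj => hω j (by simp [hj])
    by_cases hd : M.toCoxeterSystem.IsLeftDescent (M.toCoxeterSystem.wordProd ω') i
    · obtain ⟨k, hk, he⟩ := M.toCoxeterSystem.exists_eraseIdx_of_isLeftDescent hd
      refine ⟨ω'.eraseIdx k, fun j hj => hX j (List.mem_of_mem_eraseIdx hj), ?_, ?_⟩
      · have h1 := M.toCoxeterSystem.isLeftDescent_iff.mp hd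
        have h2 := List.length_eraseIdx_add_one hk
        rw [he, hred.eq] at h1
        rw [CoxeterSystem.IsReduced]
        omega
      · rw [← he, hprod, wordProd_cons]
    · refine ⟨i :: ω', ?_, ?_, by rw [wordProd_cons, wordProd_cons, hprod]⟩
      · intro j hj
        rcases List.mem_cons.mp hj with rfl | hj
        · exact hω j (by simp)
        · exact hX j hj
      · rw [CoxeterSystem.IsReduced, wordProd_cons, M.toCoxeterSystem.not_isLeftDescent_iff.mp hd,
          hred.eq, List.length_cons]

theorem exists_isReduced_of_mem_parabolic {w : M.Group} (hw : w ∈ parabolic M X) :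
    ∃ ω : List I, (∀ i ∈ ω, i ∈ X) ∧ M.toCoxeterSystem.IsReduced ω ∧
      M.toCoxeterSystem.wordProd ω = w := by
  suffices h : ∃ ω : List I, (∀ i ∈ ω, i ∈ X) ∧ M.toCoxeterSystem.wordProd ω = w by
    obtain ⟨ω, hX, rfl⟩ := h
    exact exists_isReduced_of_word M X hX
  induction hw using Subgroup.closure_induction with
  | mem x hx =>
    obtain ⟨i, hi, rfl⟩ := hx
    exact ⟨[i], by simpa using hi, by simp⟩
  | one => exact ⟨[], by simp, by simp⟩
  | mul x y _ _ hx hy =>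
    obtain ⟨ω, hX, rfl⟩ := hx
    obtain ⟨ω', hX', rfl⟩ := hy
    refine ⟨ω ++ ω', ?_, by rw [wordProd_append]⟩
    intro i hi
    rcases List.mem_append.mp hi with hi | hi
    · exact hX i hi
    · exact hX' i hi
  | inv x _ hx =>
    obtain ⟨ω, hX, rfl⟩ := hx
    exact ⟨ω.reverse, by simpa using hX, by rw [wordProd_reverse]⟩

theorem simple_mem_parabolic {i : I} : M.simple i ∈ parabolic M X ↔ i ∈ X := by
  refine ⟨fun h => ?_, fun h => Subgroup.subset_closure ⟨i, h, rfl⟩⟩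
  obtain ⟨ω, hX, hred, hprod⟩ := exists_isReduced_of_mem_parabolic M X h
  rw [← M.toCoxeterSystem_simple] at hprod
  have hlen : ω.length = 1 := by
    rw [← hred.eq, hprod, length_simple]
  obtain ⟨k, rfl⟩ := List.length_eq_one_iff.mp hlen
  rw [wordProd_singleton] at hprod
  rw [← M.toCoxeterSystem.simple_injective hprod]
  exact hX k (by simp)

theorem mem_of_isLeftDescent {w : M.Group} (hw : w ∈ parabolic M X) {i : I}
    (hi : M.toCoxeterSystem.IsLeftDescent w i) : i ∈ X := by
  obtain ⟨ω, hX, hred, rfl⟩ := exists_isReduced_of_mem_parabolic M X hw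
  obtain ⟨k, -, he⟩ := M.toCoxeterSystem.exists_eraseIdx_of_isLeftDescent hi
  rw [← simple_mem_parabolic M, ← Subgroup.mul_mem_cancel_right _ hw]
  change M.toCoxeterSystem.simple i * _ ∈ _
  rw [he]
  exact wordProd_mem_parabolic M X fun j hj => hX j (List.mem_of_mem_eraseIdx hj)

theorem mem_parabolic_inter {Y : Set I} {w : M.Group} :
    w ∈ parabolic M (X ∩ Y) ↔ w ∈ parabolic M X ∧ w ∈ parabolic M Y := by
  constructor
  · intro h
    exact ⟨Subgroup.closure_mono (Set.image_mono Set.inter_subset_left) h,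
      Subgroup.closure_mono (Set.image_mono Set.inter_subset_right) h⟩
  · rintro ⟨hX, hY⟩
    -- A reduced word of `w` on `X` is also one on `Y`: its first letter is a left descent.
    obtain ⟨ω, hω, hred, rfl⟩ := exists_isReduced_of_mem_parabolic M X hX
    clear hX
    induction ω with
    | nil => simp
    | cons i ω ih =>
      have hred' : M.toCoxeterSystem.IsReduced ω := by simpa using hred.drop 1
      have hd : M.toCoxeterSystem.IsLeftDescent (M.toCoxeterSystem.wordProd (i :: ω)) i := by
        rw [IsLeftDescent, hred.eq, wordProd_cons, simple_mul_simple_cancel_left, hred'.eq]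
        simp
      have hiY := mem_of_isLeftDescent M Y hY hd
      rw [wordProd_cons] at hY ⊢
      have hi : M.toCoxeterSystem.simple i ∈ parabolic M (X ∩ Y) :=
        Subgroup.subset_closure ⟨i, ⟨hω i (by simp), hiY⟩, rfl⟩
      refine mul_mem hi (ih (fun j hj => hω j (by simp [hj])) hred' ?_)
      exact (Subgroup.mul_mem_cancel_left _ ((simple_mem_parabolic M Y).mpr hiY)).mp hY

/-! ### Minimal coset representatives -/

/-- `v` has minimal length in its coset `W_X v`. -/
def IsMinimal (v : M.Group) : Prop :=
  ∀ u ∈ parabolic M X, coxLength M v ≤ coxLength M (u * v)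

variable {M X}

/-- Lengths add up in `W_X v` if `v` is minimal: by the exchange condition, a generator in `X` that
shortens `u v` but not `u` would give a shorter element of `W_X v`. -/
theorem IsMinimal.length_mul {v : M.Group} (hv : IsMinimal M X v) {u : M.Group}
    (hu : u ∈ parabolic M X) : coxLength M (u * v) = coxLength M u + coxLength M v := by
  obtain ⟨ω, hX, hred, rfl⟩ := exists_isReduced_of_mem_parabolic M X hu
  clear hu
  induction ω with
  | nil => simp [coxLength]
  | cons i ω ih =>
    have hred' : M.toCoxeterSystem.IsReduced ω := by simpa using hred.drop 1
    have hXω : ∀ j ∈ ω, j ∈ X := fun j hj => hX j (by simp [hj])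
    have hmem := wordProd_mem_parabolic M X hXω
    specialize ih hXω hred'
    rw [wordProd_cons, mul_assoc] at *
    by_contra hne
    have hlen : coxLength M (M.toCoxeterSystem.simple i * M.toCoxeterSystem.wordProd ω) =
        coxLength M (M.toCoxeterSystem.wordProd ω) + 1 := by
      rw [← wordProd_cons, coxLength, coxLength, hred.eq, hred'.eq, List.length_cons]
    obtain ⟨ν, hν, rfl⟩ := M.toCoxeterSystem.exists_isReduced v
    rw [← wordProd_append] at hne ih
    have hd : M.toCoxeterSystem.IsLeftDescent (M.toCoxeterSystem.wordProd (ω ++ ν)) i := by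
      by_contra hnd
      have := M.toCoxeterSystem.not_isLeftDescent_iff.mp hnd
      apply hne
      rw [hlen]
      simp only [coxLength] at *
      omega
    -- The letter cancelled by `i` lies in `ω` or in the reduced word of `v`.
    obtain ⟨k, hk, he⟩ := M.toCoxeterSystem.exists_eraseIdx_of_isLeftDescent hd
    rcases lt_or_ge k ω.length with hkω | hkω
    · rw [List.eraseIdx_append_of_lt_length hkω, wordProd_append, wordProd_append, ← mul_assoc,
        mul_right_cancel_iff] at he
      have h1 := M.toCoxeterSystem.length_wordProd_le (ω.eraseIdx k)
      have h2 := List.length_eraseIdx_add_one hkω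
      rw [← he, ← hred'.eq] at *
      simp only [coxLength] at *
      omega
    · rw [List.eraseIdx_append_of_length_le hkω, wordProd_append, wordProd_append] at he
      have hle := M.toCoxeterSystem.length_wordProd_le (ν.eraseIdx (k - ω.length))
      have hk' : k - ω.length < ν.length := by
        rw [List.length_append] at hk
        omega
      have h2 := List.length_eraseIdx_add_one hk'
      have hi : M.toCoxeterSystem.simple i ∈ parabolic M X :=
        (simple_mem_parabolic M X).mpr (hX i (by simp))
      have h3 := hv _ (mul_mem (inv_mem hmem) (mul_mem hi hmem))
      rw [mul_assoc, mul_assoc, he, inv_mul_cancel_left] at h3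
      simp only [coxLength, hν.eq] at h3
      omega

theorem IsMinimal.eq_one_of_mul {v u : M.Group} (hv : IsMinimal M X v) (hu : u ∈ parabolic M X)
    (huv : IsMinimal M X (u * v)) : u = 1 := by
  have h1 := hv.length_mul hu
  have h2 := huv _ (inv_mem hu)
  rw [inv_mul_cancel_left] at h2
  exact M.toCoxeterSystem.length_eq_zero_iff.mp (show coxLength M u = 0 by omega)

variable (M X)

theorem exists_isMinimal (w : M.Group) :
    ∃ v, IsMinimal M X v ∧ ∃ u ∈ parabolic M X, w = u * v := by
  obtain ⟨v, ⟨u, hu, hv⟩, hmin⟩ := exists_minimalFor_of_wellFoundedLT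
    (fun v => ∃ u ∈ parabolic M X, w = u * v) (coxLength M) ⟨w, 1, one_mem _, by simp⟩
  refine ⟨v, fun u' hu' => ?_, u, hu, hv⟩
  rcases le_total (coxLength M v) (coxLength M (u' * v)) with h | h
  · exact h
  · exact hmin ⟨u * u'⁻¹, mul_mem hu (inv_mem hu'), by rw [hv]; group⟩ h

variable {M X}

/-- Deodhar's lemma. If `v s_i = u x` with `x` minimal and `1 ≠ u ∈ W_X`, then comparing lengths with
`x s_i = u⁻¹ v` shows that `u` is a generator `s_q`, and the exchange condition gives `x = v`. -/
theorem IsMinimal.mul_simple {v : M.Group} (hv : IsMinimal M X v) (i : I) :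
    IsMinimal M X (v * M.simple i) ∨ ∃ q ∈ X, v * M.simple i = M.simple q * v := by
  obtain ⟨x, hx, u, hu, hvs⟩ := exists_isMinimal M X (v * M.simple i)
  by_cases hu1 : u = 1
  · left
    rwa [hvs, hu1, one_mul]
  right
  have hss : M.simple i * M.simple i = 1 := M.toCoxeterSystem.simple_mul_simple_self i
  have hxs : x * M.simple i = u⁻¹ * v := by
    rw [eq_inv_mul_iff_mul_eq, ← mul_assoc, ← hvs, mul_assoc, hss, mul_one]
  have l1 := hx.length_mul hu
  have l2 := hv.length_mul (inv_mem hu)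
  rw [← hvs] at l1
  rw [← hxs] at l2
  have l3 := M.toCoxeterSystem.length_mul_le v (M.simple i)
  have l4 := M.toCoxeterSystem.length_mul_le x (M.simple i)
  have l5 : coxLength M u⁻¹ = coxLength M u := M.toCoxeterSystem.length_inv u
  have l6 : M.toCoxeterSystem.length (M.simple i) = 1 := M.toCoxeterSystem.length_simple i
  have l7 : M.toCoxeterSystem.length u ≠ 0 := fun h =>
    hu1 (M.toCoxeterSystem.length_eq_zero_iff.mp h)
  simp only [coxLength] at *
  obtain ⟨q, rfl⟩ := M.toCoxeterSystem.length_eq_one_iff.mp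
    (show M.toCoxeterSystem.length u = 1 by omega)
  have hq : q ∈ X := (simple_mem_parabolic M X).mp hu
  refine ⟨q, hq, ?_⟩
  -- Since `s_q v` is not shorter than `v`, the letter that `s_q` cancels in `v s_i` is the last.
  obtain ⟨ν, hν, rfl⟩ := M.toCoxeterSystem.exists_isReduced v
  have hνi : M.toCoxeterSystem.wordProd (ν ++ [i]) = M.toCoxeterSystem.wordProd ν * M.simple i := by
    rw [wordProd_append, wordProd_singleton, M.toCoxeterSystem_simple]
  have hd : M.toCoxeterSystem.IsLeftDescent (M.toCoxeterSystem.wordProd (ν ++ [i])) q := by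
    rw [IsLeftDescent, hνi, l1, hvs, simple_mul_simple_cancel_left]
    omega
  obtain ⟨k, hk, he⟩ := M.toCoxeterSystem.exists_eraseIdx_of_isLeftDescent hd
  rcases lt_or_ge k ν.length with hkν | hkν
  · exfalso
    rw [List.eraseIdx_append_of_lt_length hkν, wordProd_append, wordProd_append, ← mul_assoc,
      mul_right_cancel_iff] at he
    have h1 := M.toCoxeterSystem.length_wordProd_le (ν.eraseIdx k)
    have h2 := List.length_eraseIdx_add_one hkν
    have h3 := hv _ hu
    rw [he] at h3
    simp only [coxLength, hν.eq] at h3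
    omega
  · rw [List.length_append, List.length_singleton] at hk
    have hk0 : k - ν.length = 0 := by omega
    rw [List.eraseIdx_append_of_length_le hkν, hk0, List.eraseIdx_cons_zero, List.append_nil,
      hνi] at he
    calc M.toCoxeterSystem.wordProd ν * M.simple i
        = M.toCoxeterSystem.simple q * (M.toCoxeterSystem.wordProd ν * M.simple i) *
            M.simple i := by rw [he]
      _ = _ := by rw [mul_assoc, mul_assoc, hss, mul_one, M.toCoxeterSystem_simple]

variable (M X)

/-- The element of minimal length of the coset `W_X w`. -/
noncomputable def minRep (w : M.Group) : M.Group := (exists_isMinimal M X w).choose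

theorem minRep_isMinimal (w : M.Group) : IsMinimal M X (minRep M X w) :=
  (exists_isMinimal M X w).choose_spec.1

theorem mul_minRep_inv_mem (w : M.Group) : w * (minRep M X w)⁻¹ ∈ parabolic M X := by
  obtain ⟨u, hu, h⟩ := (exists_isMinimal M X w).choose_spec.2
  rwa [minRep, mul_inv_eq_of_eq_mul h]

variable {M X}

theorem IsMinimal.minRep_eq {v w : M.Group} (hv : IsMinimal M X v)
    (h : w * v⁻¹ ∈ parabolic M X) : minRep M X w = v := by
  have h1 := mul_mem (inv_mem (mul_minRep_inv_mem M X w)) h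
  rw [mul_inv_rev, inv_inv, mul_assoc, inv_mul_cancel_left] at h1
  have h2 := hv.eq_one_of_mul h1 (by rw [inv_mul_cancel_right]; exact minRep_isMinimal M X w)
  exact mul_inv_eq_one.mp h2

theorem minRep_congr {w w' : M.Group} (h : w' * w⁻¹ ∈ parabolic M X) :
    minRep M X w' = minRep M X w := by
  refine (minRep_isMinimal M X w).minRep_eq ?_
  have := mul_mem h (mul_minRep_inv_mem M X w)
  rwa [mul_assoc, inv_mul_cancel_left] at this

theorem minRep_mul {u : M.Group} (hu : u ∈ parabolic M X) (w : M.Group) :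
    minRep M X (u * w) = minRep M X w :=
  minRep_congr (by rwa [mul_inv_cancel_right])

theorem IsMinimal.minRep_self {v : M.Group} (hv : IsMinimal M X v) : minRep M X v = v :=
  hv.minRep_eq (by rw [mul_inv_cancel]; exact one_mem _)

theorem isMinimal_one : IsMinimal M X 1 := fun u _ => by
  simp [coxLength]

theorem minRep_one : minRep M X (1 : M.Group) = 1 := isMinimal_one.minRep_self

theorem minRep_of_mem {u : M.Group} (hu : u ∈ parabolic M X) : minRep M X u = 1 := by
  rw [← mul_one u, minRep_mul hu, minRep_one]

theorem minRep_mul_simple (w : M.Group) (i : I) :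
    minRep M X (w * M.simple i) = minRep M X w * M.simple i ∨
      ∃ q ∈ X, minRep M X w * M.simple i = M.simple q * minRep M X w := by
  refine (minRep_isMinimal M X w).mul_simple i |>.imp_left fun h => ?_
  refine h.minRep_eq ?_
  rw [mul_inv_rev, mul_assoc, mul_inv_cancel_left]
  exact mul_minRep_inv_mem M X w

theorem minRep_mul_simple_of_eq {w : M.Group} {i q : I} (hq : q ∈ X)
    (h : minRep M X w * M.simple i = M.simple q * minRep M X w) :
    minRep M X (w * M.simple i) = minRep M X w := by
  refine (minRep_isMinimal M X w).minRep_eq ?_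
  have h1 : minRep M X w * M.simple i * (minRep M X w)⁻¹ = M.simple q :=
    mul_inv_eq_of_eq_mul h
  have h2 := mul_mem (mul_minRep_inv_mem M X w) ((simple_mem_parabolic M X).mpr hq)
  rw [← h1] at h2
  convert h2 using 1
  group

/-! ### The letter kept at a coset -/

variable (M X)

open scoped Classical in
/-- The letter by which `i` is replaced when it is read at the coset `W_X w` with minimal element
`v`: the `q ∈ X` with `v s_i = s_q v`. If there is none, then the letter `i` is dropped. -/
noncomputable def letter (w : M.Group) (i : I) : Option X :=
  if h : ∃ q : X, minRep M X w * M.simple i = M.simple q * minRep M X w then some h.choose else none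

variable {M X}

theorem simple_inj {i j : I} (h : M.simple i = M.simple j) : i = j :=
  M.toCoxeterSystem.simple_injective h

theorem simple_mul_self (i : I) : M.simple i * M.simple i = 1 :=
  M.toCoxeterSystem.simple_mul_simple_self i

theorem letter_eq_some_iff {w : M.Group} {i : I} {q : X} :
    letter M X w i = some q ↔ minRep M X w * M.simple i = M.simple q * minRep M X w := by
  unfold letter
  split_ifs with h
  · rw [Option.some_inj]
    constructor
    · rintro rfl
      exact h.choose_spec
    · intro h'
      have := h.choose_spec.symm.trans h'
      exact Subtype.ext (simple_inj (mul_right_cancel this))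
  · simpa using fun h' => h ⟨q, h'⟩

theorem minRep_mul_simple_of_some {w : M.Group} {i : I} {q : X} (h : letter M X w i = some q) :
    minRep M X (w * M.simple i) = minRep M X w :=
  minRep_mul_simple_of_eq q.2 (letter_eq_some_iff.mp h)

theorem minRep_mul_simple_of_none {w : M.Group} {i : I} (h : letter M X w i = none) :
    minRep M X (w * M.simple i) = minRep M X w * M.simple i := by
  refine (minRep_mul_simple w i).resolve_right ?_
  rintro ⟨q, hq, h'⟩
  rw [(letter_eq_some_iff (q := ⟨q, hq⟩)).mpr h'] at h
  cases h

theorem letter_congr {w w' : M.Group} (h : minRep M X w' = minRep M X w) (i : I) :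
    letter M X w' i = letter M X w i := by
  unfold letter
  rw [h]

theorem letter_mul_simple (w : M.Group) (i : I) :
    letter M X (w * M.simple i) i = letter M X w i := by
  rcases h : letter M X w i with - | q
  · rcases h' : letter M X (w * M.simple i) i with - | q
    · rfl
    · have h1 := minRep_mul_simple_of_some h'
      rw [mul_assoc, simple_mul_self, mul_one] at h1
      rw [letter_congr h1.symm, h] at h'
      exact h'.symm
  · rw [letter_congr (minRep_mul_simple_of_some h), h]

/-- A letter is kept if and only if its reflection lies in the parabolic subgroup. -/
theorem letter_isSome_iff (w : M.Group) (i : I) :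
    (letter M X w i).isSome ↔
      minRep M X w * M.simple i * (minRep M X w)⁻¹ ∈ parabolic M X := by
  constructor
  · intro h
    obtain ⟨q, hq⟩ := Option.isSome_iff_exists.mp h
    rw [letter_eq_some_iff] at hq
    rw [mul_inv_eq_of_eq_mul hq]
    exact (simple_mem_parabolic M X).mpr q.2
  · intro h
    by_contra hn
    rw [Option.not_isSome_iff_eq_none] at hn
    have h1 := minRep_mul_simple_of_none hn
    have h2 : minRep M X (w * M.simple i) = minRep M X w := by
      refine (minRep_isMinimal M X w).minRep_eq ?_
      have := mul_mem (mul_minRep_inv_mem M X w) h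
      convert this using 1
      group
    rw [h2] at h1
    exact M.toCoxeterSystem.length_mul_simple_ne (minRep M X w) i
      (congrArg M.toCoxeterSystem.length h1.symm)

theorem conj_mem_parabolic_iff (w t : M.Group) :
    w * t * w⁻¹ ∈ parabolic M X ↔
      minRep M X w * t * (minRep M X w)⁻¹ ∈ parabolic M X := by
  have h := mul_minRep_inv_mem M X w
  have e : w * t * w⁻¹ = w * (minRep M X w)⁻¹ *
      (minRep M X w * t * (minRep M X w)⁻¹) * (w * (minRep M X w)⁻¹)⁻¹ := by group
  rw [e, Subgroup.mul_mem_cancel_right _ (inv_mem h), Subgroup.mul_mem_cancel_left _ h]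

/-! ### The retraction of a word, letter by letter -/

variable (M X)

/-- The word obtained by reading a word without signs from the coset `W_X w` onwards. -/
noncomputable def letters : M.Group → List I → List X
  | _, [] => []
  | w, i :: ω => (letter M X w i).toList ++ letters (w * M.simple i) ω

/-- The word obtained by reading a signed word from the coset `W_X w` onwards: each letter is
replaced as prescribed by `letter`, with its sign. -/
noncomputable def retract : M.Group → SignedWord I → SignedWord X
  | _, [] => []
  | w, a :: ω => (letter M X w a.1).toList.map (fun q => (q, a.2)) ++
      retract (w * M.simple a.1) ω

variable {M X}

theorem retract_congr {w w' : M.Group} (h : w' * w⁻¹ ∈ parabolic M X) (ω : SignedWord I) :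
    retract M X w' ω = retract M X w ω := by
  induction ω generalizing w w' with
  | nil => rfl
  | cons a ω ih =>
    rw [retract, retract, letter_congr (minRep_congr h), ih]
    rwa [mul_inv_rev, mul_assoc, mul_inv_cancel_left]

theorem retract_append (w : M.Group) (ω ω' : SignedWord I) :
    retract M X w (ω ++ ω') =
      retract M X w ω ++
        retract M X (w * M.toCoxeterSystem.wordProd (ω.map Prod.fst)) ω' := by
  induction ω generalizing w with
  | nil => simp [retract]
  | cons a ω ih =>
    rw [List.cons_append, retract, retract, ih, List.append_assoc, List.map_cons, wordProd_cons,
      mul_assoc, M.toCoxeterSystem_simple]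

/-- The number of letters kept is the number of reflections of the word that lie in `w⁻¹ W_X w`. -/
theorem length_letters (w : M.Group) (ω : List I) [DecidablePred (· ∈ parabolic M X)] :
    (letters M X w ω).length =
      (M.toCoxeterSystem.leftInvSeq ω).countP fun t => w * t * w⁻¹ ∈ parabolic M X := by
  induction ω generalizing w with
  | nil => rfl
  | cons i ω ih =>
    rw [letters, List.length_append, ih, leftInvSeq, List.countP_cons, List.countP_map, add_comm]
    congr 1
    · apply List.countP_congr
      intro t _
      simp [M.toCoxeterSystem_simple, mul_assoc]
    · have h := letter_isSome_iff (X := X) w i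
      rw [← conj_mem_parabolic_iff] at h
      rw [M.toCoxeterSystem_simple]
      rcases hl : letter M X w i with - | q
      · rw [hl] at h
        simp [← h]
      · rw [hl] at h
        simp [← h]

/-! ### Invariance under braid relations -/

section Dihedral

variable {z : M.Group}

theorem exists_doubleMinimal (J : Set I) (w : M.Group) :
    ∃ z, IsMinimal M X z ∧ IsMinimal M J z⁻¹ ∧
      ∃ d ∈ parabolic M J, (w * (z * d)⁻¹) ∈ parabolic M X := by
  obtain ⟨z, ⟨u, hu, d, hd, hz⟩, hmin⟩ := exists_minimalFor_of_wellFoundedLT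
    (fun z => ∃ u ∈ parabolic M X, ∃ d ∈ parabolic M J, w = u * (z * d)) (coxLength M)
    ⟨w, 1, one_mem _, 1, one_mem _, by simp⟩
  refine ⟨z, fun u' hu' => ?_, fun d' hd' => ?_, d, hd, by rwa [hz, mul_inv_cancel_right]⟩
  · rcases le_total (coxLength M z) (coxLength M (u' * z)) with h | h
    · exact h
    · exact hmin ⟨u * u'⁻¹, mul_mem hu (inv_mem hu'), d, hd, by rw [hz]; group⟩ h
  · have e : coxLength M (d' * z⁻¹) = coxLength M (z * d'⁻¹) := by
      rw [coxLength, ← length_inv, mul_inv_rev, inv_inv, coxLength]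
    have e' : coxLength M z⁻¹ = coxLength M z := M.toCoxeterSystem.length_inv z
    rw [e, e']
    rcases le_total (coxLength M z) (coxLength M (z * d'⁻¹)) with h | h
    · exact h
    · exact hmin ⟨u, hu, d' * d, mul_mem hd' hd, by rw [hz]; group⟩ h

theorem length_mul_of_isMinimal_inv {J : Set I} (hz : IsMinimal M J z⁻¹) {d : M.Group}
    (hd : d ∈ parabolic M J) : coxLength M (z * d) = coxLength M z + coxLength M d := by
  have h := hz.length_mul (inv_mem hd)
  simp only [coxLength] at *
  rwa [← mul_inv_rev, length_inv, length_inv, length_inv, add_comm] at h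

theorem minRep_mul_mem {J : Set I} (hz : IsMinimal M X z) {d : M.Group}
    (hd : d ∈ parabolic M J) : ∃ d' ∈ parabolic M J, minRep M X (z * d) = z * d' := by
  obtain ⟨ω, hω, -, rfl⟩ := exists_isReduced_of_mem_parabolic M J hd
  clear hd
  induction ω using List.reverseRecOn with
  | nil => exact ⟨1, one_mem _, by simp [hz.minRep_self]⟩
  | append_singleton ω k ih =>
    obtain ⟨d', hd', h⟩ := ih fun l hl => hω l (by simp [hl])
    rw [wordProd_append, wordProd_singleton, M.toCoxeterSystem_simple, ← mul_assoc]
    rcases minRep_mul_simple (X := X) (z * M.toCoxeterSystem.wordProd ω) k with h' | ⟨q, hq, h'⟩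
    · exact ⟨d' * M.simple k, mul_mem hd' ((simple_mem_parabolic M J).mpr (hω k (by simp))),
        by rw [h', h, mul_assoc]⟩
    · exact ⟨d', hd', by rw [minRep_mul_simple_of_eq hq h', h]⟩

/-- A letter kept in the double coset of `z` is already kept at `z`, up to a change of the letter
read: `v s_k = s_q v` with `v = z d` gives `z t = s_q z` for a reflection `t` of `W_J`, and comparing
lengths shows that `t` is simple. -/
theorem exists_of_letter_eq_some {J : Set I} (hz : IsMinimal M X z) (hz' : IsMinimal M J z⁻¹)
    {w d : M.Group} (hd : d ∈ parabolic M J) (hw : w * (z * d)⁻¹ ∈ parabolic M X) {k : I}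
    (hk : k ∈ J) {q : X} (h : letter M X w k = some q) :
    ∃ l ∈ J, z * M.simple l = M.simple q * z := by
  obtain ⟨d', hd', he⟩ := minRep_mul_mem hz hd
  rw [letter_eq_some_iff, minRep_congr hw, he] at h
  set t := d' * M.simple k * d'⁻¹ with ht
  have htJ : t ∈ parabolic M J :=
    mul_mem (mul_mem hd' ((simple_mem_parabolic M J).mpr hk)) (inv_mem hd')
  have hzt : z * t = M.simple q * z := by
    rw [ht, ← mul_assoc, ← mul_assoc, h]
    group
  have l1 := length_mul_of_isMinimal_inv hz' htJ
  have l2 := hz.length_mul ((simple_mem_parabolic M X).mpr q.2)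
  have l3 : coxLength M (M.simple q) = 1 := M.toCoxeterSystem.length_simple (q : I)
  rw [hzt, l2, l3] at l1
  have l4 : coxLength M t = 1 := by omega
  obtain ⟨l, hl⟩ := M.toCoxeterSystem.length_eq_one_iff.mp l4
  rw [M.toCoxeterSystem_simple] at hl
  rw [hl] at htJ hzt
  exact ⟨l, (simple_mem_parabolic M J).mp htJ, hzt⟩

theorem exists_of_mem_letters {J : Set I} (hz : IsMinimal M X z) (hz' : IsMinimal M J z⁻¹)
    {w d : M.Group} (hd : d ∈ parabolic M J) (hw : w * (z * d)⁻¹ ∈ parabolic M X) {ω : List I}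
    (hω : ∀ k ∈ ω, k ∈ J) {q : X} (h : q ∈ letters M X w ω) :
    ∃ l ∈ J, z * M.simple l = M.simple q * z := by
  induction ω generalizing w d with
  | nil => simp [letters] at h
  | cons k ω ih =>
    rw [letters, List.mem_append] at h
    have hk : k ∈ J := hω k (by simp)
    rcases h with h | h
    · exact exists_of_letter_eq_some hz hz' hd hw hk (by simpa using h)
    · refine ih (mul_mem hd ((simple_mem_parabolic M J).mpr hk)) ?_
        (fun l hl => hω l (by simp [hl])) h
      rwa [← mul_assoc, mul_inv_rev, mul_assoc, mul_inv_cancel_left]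

/-- If all generators of `W_J` are kept at `z`, then the whole double coset of `z` is the coset
`W_X z`, and all letters are kept in it. -/
theorem letters_eq_map {J : Set I} (f : I → X)
    (hf : ∀ k ∈ J, z * M.simple k = M.simple (f k) * z) {w : M.Group} (hw : minRep M X w = z)
    {ω : List I} (hω : ∀ k ∈ ω, k ∈ J) : letters M X w ω = ω.map f := by
  induction ω generalizing w with
  | nil => rfl
  | cons k ω ih =>
    have hl : letter M X w k = some (f k) := by
      rw [letter_eq_some_iff, hw]
      exact hf k (hω k (by simp))
    rw [letters, hl, ih (by rw [minRep_mul_simple_of_some hl, hw]) fun l hl => hω l (by simp [hl])]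
    rfl

theorem map_alternatingWord {B C : Type*} (f : B → C) (i j : B) (m : ℕ) :
    (alternatingWord i j m).map f = alternatingWord (f i) (f j) m := by
  induction m generalizing i j with
  | zero => rfl
  | succ m ih => simp [alternatingWord, ih]

theorem mem_alternatingWord (i j : I) (m : ℕ) :
    ∀ k ∈ alternatingWord i j m, k ∈ ({i, j} : Set I) := by
  induction m generalizing i j with
  | zero => simp [alternatingWord]
  | succ m ih =>
    intro k hk
    rw [alternatingWord, List.concat_eq_append, List.mem_append] at hk
    rcases hk with hk | hk
    · rw [Set.pair_comm]
      exact ih j i k hk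
    · exact Or.inr (List.mem_singleton.mp hk)

theorem coxeterMatrix_eq_of_conj {a b i j : I}
    (hi : z * M.simple i = M.simple a * z) (hj : z * M.simple j = M.simple b * z) :
    M a b = M i j := by
  have hconj : ∀ n : ℕ, (M.simple a * M.simple b) ^ n =
      z * (M.simple i * M.simple j) ^ n * z⁻¹ := by
    intro n
    rw [← conj_pow]
    congr 1
    rw [← mul_assoc, hi, mul_assoc (M.simple a), hj]
    group
  apply Nat.dvd_antisymm
  · apply M.toCoxeterSystem.dvd_of_pow_eq_one
    rw [M.toCoxeterSystem_simple, hconj, ← M.toCoxeterSystem_simple, simple_mul_simple_pow]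
    simp
  · apply M.toCoxeterSystem.dvd_of_pow_eq_one
    have h := hconj (M a b)
    rw [← M.toCoxeterSystem_simple, simple_mul_simple_pow] at h
    have h' := eq_mul_inv_iff_mul_eq.mp h
    rw [one_mul] at h'
    exact mul_eq_left.mp h'.symm

/-- Reading both sides of a braid relation from the same coset gives either the same word twice or
both sides of a braid relation. -/
theorem letters_braidWord (w : M.Group) (i j : I) :
    letters M X w (braidWord M i j) = letters M X w (braidWord M j i) ∨
      ∃ a b : X, letters M X w (braidWord M i j) = braidWord (restrict M X) a b ∧
        letters M X w (braidWord M j i) = braidWord (restrict M X) b a := by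
  classical
  by_cases hij : i = j
  · exact Or.inl (by rw [hij])
  obtain ⟨z, hz, hz', d, hd, hw⟩ := exists_doubleMinimal (X := X) {i, j} w
  have hmem : ∀ k ∈ braidWord M j i, k ∈ ({i, j} : Set I) := by
    rw [Set.pair_comm]
    exact mem_alternatingWord j i _
  by_cases hboth : (∃ a : X, z * M.simple i = M.simple a * z) ∧
      ∃ b : X, z * M.simple j = M.simple b * z
  · right
    obtain ⟨⟨a, ha⟩, b, hb⟩ := hboth
    refine ⟨a, b, ?_⟩
    set f : I → X := fun k => if k = i then a else b with hf
    have fi : f i = a := by simp [hf]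
    have fj : f j = b := by simp [hf, Ne.symm hij]
    have hf' : ∀ k ∈ ({i, j} : Set I), z * M.simple k = M.simple (f k) * z := by
      rintro k (rfl | rfl)
      · rw [fi, ha]
      · rw [fj, hb]
    have hdz : z * d * z⁻¹ ∈ parabolic M X := by
      have hle : parabolic M {i, j} ≤ (parabolic M X).comap (MulAut.conj z).toMonoidHom := by
        rw [parabolic, Subgroup.closure_le]
        rintro _ ⟨k, hk, rfl⟩
        change z * M.simple k * z⁻¹ ∈ parabolic M X
        rw [hf' k hk, mul_inv_cancel_right]
        exact (simple_mem_parabolic M X).mpr (f k).2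
      exact hle hd
    have hmin : minRep M X w = z := by
      rw [minRep_congr hw]
      exact hz.minRep_eq hdz
    have hm : M a b = M i j := coxeterMatrix_eq_of_conj ha hb
    rw [letters_eq_map f hf' hmin (mem_alternatingWord i j _), letters_eq_map f hf' hmin hmem,
      map_alternatingWord, map_alternatingWord, fi, fj]
    refine ⟨congrArg _ hm.symm, congrArg _ ?_⟩
    change M j i = M b a
    rw [M.symmetric, M.symmetric b, hm]
  · -- All letters kept are equal, and both words have the same reflections, whence as many letters.
    left
    have hall : ∀ q ∈ letters M X w (braidWord M i j) ++ letters M X w (braidWord M j i),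
        ∃ l ∈ ({i, j} : Set I), z * M.simple l = M.simple q * z := by
      intro q hq
      rcases List.mem_append.mp hq with hq | hq
      · exact exists_of_mem_letters hz hz' hd hw (mem_alternatingWord i j _) hq
      · exact exists_of_mem_letters hz hz' hd hw hmem hq
    have hlen : (letters M X w (braidWord M i j)).length =
        (letters M X w (braidWord M j i)).length := by
      rw [length_letters, length_letters]
      exact (M.toCoxeterSystem.leftInvSeq_braidWord_perm i j).countP_eq _
    have huniq : ∀ p q : X, (∃ l ∈ ({i, j} : Set I), z * M.simple l = M.simple p * z) →
        (∃ l ∈ ({i, j} : Set I), z * M.simple l = M.simple q * z) → p = q := by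
      rintro p q ⟨l, hl, hp⟩ ⟨l', hl', hq⟩
      have : l = l' := by
        rcases hl with rfl | rfl <;> rcases hl' with rfl | rfl
        · rfl
        · exact absurd ⟨⟨p, hp⟩, q, hq⟩ hboth
        · exact absurd ⟨⟨q, hq⟩, p, hp⟩ hboth
        · rfl
      subst this
      exact Subtype.ext (simple_inj (mul_right_cancel (hp.symm.trans hq)))
    rcases hl : letters M X w (braidWord M i j) with - | ⟨q, L⟩
    · rw [hl] at hlen
      exact (List.length_eq_zero_iff.mp hlen.symm).symm
    · rw [← hl]
      have hq := hall q (by simp [hl])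
      have h1 : letters M X w (braidWord M i j) = List.replicate _ q :=
        List.eq_replicate_of_mem fun p hp => huniq p q (hall p (by simp [hp])) hq
      have h2 : letters M X w (braidWord M j i) = List.replicate _ q :=
        List.eq_replicate_of_mem fun p hp => huniq p q (hall p (by simp [hp])) hq
      rw [h1, h2, hlen]

end Dihedral

/-! ### Words and their sequences of reflections -/

theorem signedReflections_cons (a : I × Bool) (ω : SignedWord I) :
    signedReflections M (a :: ω) = (M.simple a.1, a.2) ::
      (signedReflections M ω).map (Prod.map (MulAut.conj (M.simple a.1)) id) := by
  simp [signedReflections, leftInvSeq, M.toCoxeterSystem_simple, List.zip_map_left]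

theorem length_signedReflections (ω : SignedWord I) :
    (signedReflections M ω).length = ω.length := by
  simp [signedReflections]

theorem signedReflections_injective : Function.Injective (signedReflections M) := by
  intro ω
  induction ω with
  | nil =>
    intro ω' h
    have := congrArg List.length h
    rw [length_signedReflections, length_signedReflections] at this
    exact (List.length_eq_zero_iff.mp this.symm).symm
  | cons a ω ih =>
    intro ω' h
    rcases ω' with - | ⟨b, ω'⟩
    · have := congrArg List.length h
      rw [length_signedReflections, length_signedReflections] at this
      simp at this
    · rw [signedReflections_cons, signedReflections_cons, List.cons.injEq, Prod.mk.injEq] at h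
      obtain ⟨⟨h1, h2⟩, h3⟩ := h
      have hab : a = b := Prod.ext (simple_inj h1) h2
      subst hab
      rw [ih (List.map_injective_iff.mpr
        (Prod.map_injective.mpr ⟨MulEquiv.injective _, Function.injective_id⟩) h3)]

theorem inclWord_injective : Function.Injective (inclWord : SignedWord X → SignedWord I) :=
  List.map_injective_iff.mpr fun a b h => by
    rw [Prod.mk.injEq] at h
    exact Prod.ext (Subtype.ext h.1) h.2

open scoped Classical in
/-- The reflections of the word read from the coset `W_X w` with minimal element `v` are the
`v`-conjugates of the reflections of the given word that lie in `W_X`. -/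
theorem signedReflections_retract (w : M.Group) (ω : SignedWord I) :
    signedReflections M (inclWord (retract M X w ω)) =
      ((signedReflections M ω).map (Prod.map (MulAut.conj (minRep M X w)) id)).filter
        fun p => p.1 ∈ parabolic M X := by
  induction ω generalizing w with
  | nil => rfl
  | cons a ω ih =>
    have hiff := letter_isSome_iff (X := X) w a.1
    rw [retract, signedReflections_cons, List.map_cons, List.map_map, List.filter_cons]
    rcases h : letter M X w a.1 with - | q
    · rw [h] at hiff
      have hn : minRep M X w * M.simple a.1 * (minRep M X w)⁻¹ ∉ parabolic M X := by
        simpa using hiff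
      simp only [Prod.map_apply, MulAut.conj_apply, hn, decide_false, Bool.false_eq_true, if_false,
        Option.toList_none, List.map_nil, List.nil_append]
      rw [ih, minRep_mul_simple_of_none h, map_mul, MulAut.mul_def]
      rfl
    · have hq := letter_eq_some_iff.mp h
      have hc : minRep M X w * M.simple a.1 * (minRep M X w)⁻¹ = M.simple q :=
        mul_inv_eq_of_eq_mul hq
      have hm : M.simple q ∈ parabolic M X := (simple_mem_parabolic M X).mpr q.2
      simp only [Prod.map_apply, MulAut.conj_apply, hc, hm, decide_true, if_true,
        Option.toList_some, List.map_cons, List.map_nil, List.cons_append, List.nil_append,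
        id_eq]
      rw [inclWord, List.map_cons, signedReflections_cons, ← inclWord, ih,
        minRep_mul_simple_of_some h]
      congr 1
      have hf : Prod.map (MulAut.conj (minRep M X w)) (id : Bool → Bool) ∘
          Prod.map (MulAut.conj (M.simple a.1)) id =
          Prod.map (MulAut.conj (M.simple q)) id ∘ Prod.map (MulAut.conj (minRep M X w)) id := by
        rw [Prod.map_comp_map, Prod.map_comp_map, ← MulAut.coe_mul, ← MulAut.coe_mul, ← map_mul,
          ← map_mul, hq]
      rw [hf, ← List.map_map, List.filter_map (f := Prod.map (MulAut.conj (M.simple q)) id)]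
      congr 1
      refine List.filter_congr fun p _ => ?_
      simp only [Function.comp_apply, Prod.map_fst, MulAut.conj_apply,
        Subgroup.mul_mem_cancel_right _ (inv_mem hm), Subgroup.mul_mem_cancel_left _ hm]

theorem isRetractedWord_retract (ω : SignedWord I) : IsRetractedWord M X ω (retract M X 1 ω) := by
  rw [IsRetractedWord, signedReflections_retract, minRep_one, map_one]
  congr 1
  exact List.map_id _

theorem IsRetractedWord.unique {ω : SignedWord I} {ω₁ ω₂ : SignedWord X}
    (h₁ : IsRetractedWord M X ω ω₁) (h₂ : IsRetractedWord M X ω ω₂) : ω₁ = ω₂ :=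
  inclWord_injective (signedReflections_injective (h₁.trans h₂.symm))

theorem piStar_eq_retract (ω : SignedWord I) : piStar M X ω = retract M X 1 ω :=
  (Classical.epsilon_spec (p := fun ω' => IsRetractedWord M X ω ω')
    ⟨_, isRetractedWord_retract ω⟩).unique (isRetractedWord_retract ω)

theorem isRetractedWord_piStar (ω : SignedWord I) : IsRetractedWord M X ω (piStar M X ω) := by
  rw [piStar_eq_retract]
  exact isRetractedWord_retract ω

theorem length_retract_le (w : M.Group) (ω : SignedWord I) :
    (retract M X w ω).length ≤ ω.length := by
  induction ω generalizing w with
  | nil => rfl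
  | cons a ω ih =>
    rw [retract, List.length_append, List.length_cons, List.length_map, add_comm]
    refine Nat.add_le_add (ih _) ?_
    cases letter M X w a.1 <;> simp

theorem letter_of_mem {w : M.Group} (hw : w ∈ parabolic M X) (q : X) :
    letter M X w q = some q := by
  rw [letter_eq_some_iff, minRep_of_mem hw, one_mul, mul_one]

theorem letters_map_val {w : M.Group} (hw : w ∈ parabolic M X) (ω : List X) :
    letters M X w (ω.map Subtype.val) = ω := by
  induction ω generalizing w with
  | nil => rfl
  | cons q ω ih =>
    rw [List.map_cons, letters, letter_of_mem hw,
      ih (mul_mem hw ((simple_mem_parabolic M X).mpr q.2))]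
    rfl

theorem retract_inclWord {w : M.Group} (hw : w ∈ parabolic M X) (ω : SignedWord X) :
    retract M X w (inclWord ω) = ω := by
  induction ω generalizing w with
  | nil => rfl
  | cons q ω ih =>
    rw [inclWord, List.map_cons, retract, letter_of_mem hw, ← inclWord,
      ih (mul_mem hw ((simple_mem_parabolic M X).mpr q.1.2))]
    rfl

theorem IsWordOn.exists_inclWord {ω : SignedWord I} (h : IsWordOn X ω) :
    ∃ ω' : SignedWord X, inclWord ω' = ω := by
  induction ω with
  | nil => exact ⟨[], rfl⟩
  | cons a ω ih =>
    obtain ⟨ω', rfl⟩ := ih fun b hb => h b (by simp [hb])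
    exact ⟨(⟨a.1, h a (by simp)⟩, a.2) :: ω', rfl⟩

theorem isWordOn_inclWord (ω : SignedWord X) : IsWordOn X (inclWord ω) := by
  intro a ha
  obtain ⟨b, -, rfl⟩ := List.mem_map.mp ha
  exact b.1.2

theorem isWordOn_of_length_retract {w : M.Group} (hw : w ∈ parabolic M X) {ω : SignedWord I}
    (h : (retract M X w ω).length = ω.length) : IsWordOn X ω := by
  induction ω generalizing w with
  | nil => simp [IsWordOn]
  | cons a ω ih =>
    have hle := length_retract_le (X := X) (w * M.simple a.1) ω
    rw [retract, List.length_append, List.length_map, List.length_cons] at h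
    rcases hl : letter M X w a.1 with - | q
    · rw [hl, Option.toList_none, List.length_nil] at h
      omega
    · have hq := letter_eq_some_iff.mp hl
      rw [minRep_of_mem hw, one_mul, mul_one] at hq
      have ha : a.1 ∈ X := by
        rw [simple_inj hq]
        exact q.2
      rw [hl, Option.toList_some, List.length_singleton] at h
      intro b hb
      rcases List.mem_cons.mp hb with rfl | hb
      · exact ha
      · exact ih (mul_mem hw ((simple_mem_parabolic M X).mpr ha)) (by omega) b hb

/-! ### The decomposition in the Coxeter group -/

theorem theta_artinGen (i : I) : theta M (artinGen M i) = M.simple i :=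
  PresentedGroup.toGroup.of _

theorem theta_wordElt (ω : SignedWord I) :
    theta M (wordElt M ω) = M.toCoxeterSystem.wordProd (ω.map Prod.fst) := by
  rw [wordElt, theta]
  change FreeGroup.lift M.simple (FreeGroup.mk ω) = _
  rw [FreeGroup.lift_mk, wordProd, List.map_map]
  congr 1
  refine List.map_congr_left fun a _ => ?_
  have h : (M.simple a.1)⁻¹ = M.simple a.1 := M.toCoxeterSystem.inv_simple a.1
  cases a.2 <;> simp [h, M.toCoxeterSystem_simple]

theorem tau_simple (q : X) : tau M X ((restrict M X).simple q) = M.simple q :=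
  CoxeterSystem.lift_apply_simple _ _ q

theorem tau_wordProd (ω : List X) :
    tau M X ((restrict M X).toCoxeterSystem.wordProd ω) =
      M.toCoxeterSystem.wordProd (ω.map Subtype.val) := by
  induction ω with
  | nil => simp
  | cons q ω ih =>
    rw [wordProd_cons, List.map_cons, wordProd_cons, map_mul, ih,
      (restrict M X).toCoxeterSystem_simple, tau_simple, M.toCoxeterSystem_simple]

theorem tau_theta_wordElt (ω : SignedWord X) :
    tau M X (theta (restrict M X) (wordElt (restrict M X) ω)) =
      M.toCoxeterSystem.wordProd ((ω.map Prod.fst).map Subtype.val) := by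
  rw [theta_wordElt, tau_wordProd]

/-- In `W_I`, reading a word turns `v · ω` into the product of the word produced and the minimal
representative of the coset at which the reading ends. -/
theorem wordProd_retract_mul_minRep (w : M.Group) (ω : SignedWord I) :
    M.toCoxeterSystem.wordProd (((retract M X w ω).map Prod.fst).map Subtype.val) *
        minRep M X (w * M.toCoxeterSystem.wordProd (ω.map Prod.fst)) =
      minRep M X w * M.toCoxeterSystem.wordProd (ω.map Prod.fst) := by
  induction ω generalizing w with
  | nil => simp [retract]
  | cons a ω ih =>
    specialize ih (w * M.simple a.1)
    rw [retract, List.map_cons, wordProd_cons, M.toCoxeterSystem_simple, ← mul_assoc w,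
      ← mul_assoc (minRep M X w)]
    rcases h : letter M X w a.1 with - | q
    · rw [minRep_mul_simple_of_none h] at ih
      simpa using ih
    · rw [minRep_mul_simple_of_some h] at ih
      rw [letter_eq_some_iff.mp h, mul_assoc (M.simple q), ← ih]
      simp [wordProd_cons, M.toCoxeterSystem_simple, mul_assoc]

/-! ### The wreath product and the induced maps on groups -/

section Wreath

variable {G : Type*} [Group G]

/-- The action of a group `H` on the functions `H → G` by right translation of the argument. -/
def translation (H G : Type*) [Group H] [Group G] : H →* MulAut (H → G) where
  toFun h :=
    { toFun := fun f w => f (w * h)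
      invFun := fun f w => f (w * h⁻¹)
      left_inv := fun f => by simp
      right_inv := fun f => by simp
      map_mul' := fun _ _ => rfl }
  map_one' := by ext; simp
  map_mul' h h' := by ext; simp [mul_assoc]

theorem translation_apply {H : Type*} [Group H] (h w : H) (f : H → G) :
    translation H G h f w = f (w * h) := rfl

variable (M) in
/-- The element of the wreath product `(W_I → G) ⋊ W_I` that records the letter replacing `i` at
each coset, as an element of `G`, together with the generator `s_i`. -/
noncomputable def wreathGen (g : X → G) (i : I) :
    (M.Group → G) ⋊[translation M.Group G] M.Group :=
  ⟨fun w => ((letter M X w i).toList.map g).prod, M.simple i⟩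

theorem prod_wreathGen_right (g : X → G) (ω : List I) :
    ((ω.map (wreathGen M g)).prod).right = M.toCoxeterSystem.wordProd ω := by
  induction ω with
  | nil => simp
  | cons i ω ih =>
    rw [List.map_cons, List.prod_cons, SemidirectProduct.mul_right, ih, wordProd_cons]
    rfl

theorem prod_wreathGen_left (g : X → G) (ω : List I) (w : M.Group) :
    ((ω.map (wreathGen M g)).prod).left w = ((letters M X w ω).map g).prod := by
  induction ω generalizing w with
  | nil => simp [letters]
  | cons i ω ih =>
    rw [List.map_cons, List.prod_cons, SemidirectProduct.mul_left, Pi.mul_apply,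
      translation_apply, ih, letters, List.map_append, List.prod_append]
    rfl

/-- Braid relations in `G` between the values of `g` lift to braid relations in the wreath product. -/
theorem prod_wreathGen_braidWord {g : X → G}
    (hg : ∀ a b : X, ((braidWord (restrict M X) a b).map g).prod =
      ((braidWord (restrict M X) b a).map g).prod) (i j : I) :
    ((braidWord M i j).map (wreathGen M g)).prod =
      ((braidWord M j i).map (wreathGen M g)).prod := by
  refine SemidirectProduct.ext ?_ ?_
  · funext w
    rw [prod_wreathGen_left, prod_wreathGen_left]
    rcases letters_braidWord (X := X) w i j with h | ⟨a, b, h, h'⟩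
    · rw [h]
    · rw [h, h', hg]
  · rw [prod_wreathGen_right, prod_wreathGen_right, wordProd_braidWord_eq]

theorem lift_prod_of {B : Type*} (g : B → G) (ω : List B) :
    FreeGroup.lift g (ω.map FreeGroup.of).prod = (ω.map g).prod := by
  rw [map_list_prod, List.map_map]
  congr 1
  exact List.map_congr_left fun i _ => FreeGroup.lift_apply_of

theorem lift_wreathGen_left (g : X → G) (ω : SignedWord I) (w : M.Group) :
    (FreeGroup.lift (wreathGen M g) (FreeGroup.mk ω)).left w =
      FreeGroup.lift g (FreeGroup.mk (retract M X w ω)) := by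
  rw [FreeGroup.lift_mk, FreeGroup.lift_mk]
  induction ω generalizing w with
  | nil => simp [retract]
  | cons a ω ih =>
    obtain ⟨i, ε⟩ := a
    have hinv : (M.simple i)⁻¹ = M.simple i := M.toCoxeterSystem.inv_simple i
    rw [List.map_cons, List.prod_cons, SemidirectProduct.mul_left, Pi.mul_apply,
      translation_apply, retract, List.map_append, List.prod_append]
    have hr : (cond ε (wreathGen M g i) (wreathGen M g i)⁻¹).right = M.simple i := by
      cases ε
      · exact hinv
      · rfl
    rw [hr, ih]
    congr 1
    cases ε
    · simp only [cond_false, SemidirectProduct.inv_left, translation_apply, Pi.inv_apply]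
      change (((letter M X (w * (M.simple i)⁻¹) i).toList.map g).prod)⁻¹ = _
      rw [hinv, letter_mul_simple]
      cases letter M X w i <;> simp
    · simp only [cond_true, wreathGen]
      cases letter M X w i <;> simp

end Wreath

theorem artinGen_braidWord {B : Type*} (N : CoxeterMatrix B) (a b : B) :
    ((braidWord N a b).map (artinGen N)).prod = ((braidWord N b a).map (artinGen N)).prod := by
  have h : PresentedGroup.mk (braidRelators N) _ = 1 :=
    PresentedGroup.one_of_mem ⟨(a, b), rfl⟩
  rw [map_mul, map_inv, mul_inv_eq_one, map_list_prod, map_list_prod, List.map_map,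
    List.map_map] at h
  exact h

variable (M X) in
/-- The homomorphism from `A_I` to the wreath product of `A_X` and `W_I` describing how the letters
of a word are replaced, at every coset of `W_X`. -/
noncomputable def artinWreath : ArtinGroup M →*
    (M.Group → ArtinGroup (restrict M X)) ⋊[translation M.Group _] M.Group :=
  PresentedGroup.toGroup (f := wreathGen M (artinGen (restrict M X))) <| by
    rintro _ ⟨⟨i, j⟩, rfl⟩
    rw [map_mul, map_inv, mul_inv_eq_one, lift_prod_of, lift_prod_of]
    exact prod_wreathGen_braidWord (artinGen_braidWord _) i j

theorem lift_artinGen (ω : SignedWord X) :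
    FreeGroup.lift (artinGen (restrict M X)) (FreeGroup.mk ω) = wordElt (restrict M X) ω := by
  rw [wordElt]
  congr 1
  ext q
  rw [FreeGroup.lift_apply_of]
  rfl

theorem artinWreath_wordElt_left (ω : SignedWord I) (w : M.Group) :
    (artinWreath M X (wordElt M ω)).left w = wordElt (restrict M X) (retract M X w ω) := by
  rw [← lift_artinGen, ← lift_wreathGen_left]
  rfl

theorem artinWreath_right (a : ArtinGroup M) : (artinWreath M X a).right = theta M a := by
  have h : SemidirectProduct.rightHom.comp (artinWreath M X) = theta M := by
    refine PresentedGroup.ext fun i => ?_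
    exact (theta_artinGen i).symm
  exact DFunLike.congr_fun h a

theorem exists_wordElt (a : ArtinGroup M) : ∃ ω : SignedWord I, wordElt M ω = a := by
  classical
  obtain ⟨x, rfl⟩ := PresentedGroup.mk_surjective _ a
  exact ⟨x.toWord, by rw [wordElt, FreeGroup.mk_toWord]⟩

/-! ### Injectivity of `W_X → W_I` -/

/-- For involutions, the quotient of the two alternating products of length `m` is the `m`-th power
of the product, so that braid relations amount to Coxeter relations. -/
theorem inv_prod_mul_prod_alternatingWord {G B : Type*} [Group G] (g : B → G) {i j : B}
    (hi : g i * g i = 1) (hj : g j * g j = 1) (m : ℕ) :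
    (((alternatingWord j i m).map g).prod)⁻¹ * ((alternatingWord i j m).map g).prod =
      (g i * g j) ^ m := by
  induction m generalizing i j with
  | zero => simp [alternatingWord]
  | succ m ih =>
    have h := ih hj hi
    simp only [alternatingWord, List.concat_eq_append, List.map_append, List.prod_append,
      List.map_singleton, List.prod_singleton, mul_inv_rev]
    rw [mul_assoc, ← mul_assoc _ _ (g j), h, inv_eq_of_mul_eq_one_left hi, mul_pow_mul,
      ← mul_assoc, ← pow_succ']

variable (M X) in
/-- With values in `W_X` the letter maps also satisfy the quadratic relations, so that they give a
homomorphism on `W_I` rather than on `A_I`. -/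
theorem wreathGen_isLiftable : M.IsLiftable (wreathGen M (restrict M X).simple) := by
  have hsq : ∀ i, wreathGen M (restrict M X).simple i * wreathGen M (restrict M X).simple i = 1 := by
    intro i
    refine SemidirectProduct.ext ?_ (simple_mul_self i)
    funext w
    change ((letter M X w i).toList.map (restrict M X).simple).prod *
      ((letter M X (w * M.simple i) i).toList.map (restrict M X).simple).prod = 1
    rw [letter_mul_simple]
    cases letter M X w i with
    | none => simp
    | some q => simpa using simple_mul_self q
  intro i j
  rw [← inv_prod_mul_prod_alternatingWord _ (hsq i) (hsq j), inv_mul_eq_one]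
  have h := prod_wreathGen_braidWord (M := M) (X := X) (g := (restrict M X).simple)
    (fun a b => (restrict M X).toCoxeterSystem.wordProd_braidWord_eq a b) j i
  rwa [braidWord, braidWord, M.symmetric j i] at h

theorem tau_injective : Function.Injective (tau M X) := by
  have key : ∀ u, (M.toCoxeterSystem.lift ⟨_, wreathGen_isLiftable M X⟩ (tau M X u)).left 1 = u := by
    intro u
    obtain ⟨ω, rfl⟩ := (restrict M X).toCoxeterSystem.wordProd_surjective u
    have h : ∀ ν : List I, M.toCoxeterSystem.lift ⟨_, wreathGen_isLiftable M X⟩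
        (M.toCoxeterSystem.wordProd ν) = (ν.map (wreathGen M (restrict M X).simple)).prod := by
      intro ν
      induction ν with
      | nil => simp
      | cons i ν ih => rw [wordProd_cons, map_mul, ih, lift_apply_simple, List.map_cons,
          List.prod_cons]
    rw [tau_wordProd, h, prod_wreathGen_left, letters_map_val (one_mem _)]
    rfl
  intro u u' h
  rw [← key u, h, key]

/-! ### Restriction to subgraphs -/

theorem signedReflections_inclWord (ω : SignedWord X) :
    signedReflections M (inclWord ω) =
      (signedReflections (restrict M X) ω).map (Prod.map (tau M X) id) := by
  induction ω with
  | nil => rfl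
  | cons a ω ih =>
    rw [inclWord, List.map_cons, signedReflections_cons, signedReflections_cons, ← inclWord, ih,
      List.map_cons, List.map_map, List.map_map, Prod.map_apply, tau_simple]
    congr 2
    funext p
    refine Prod.ext ?_ rfl
    simp [tau_simple]

theorem tau_mem_parabolic_iff {Y : Set I} {r : (restrict M Y).Group} :
    tau M Y r ∈ parabolic M X ↔ r ∈ parabolic (restrict M Y) {y : Y | (y : I) ∈ X} := by
  have hmap : (parabolic (restrict M Y) {y : Y | (y : I) ∈ X}).map (tau M Y) =
      parabolic M (X ∩ Y) := by
    rw [parabolic, MonoidHom.map_closure, parabolic, ← Set.image_comp]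
    congr 1
    ext w
    constructor
    · rintro ⟨y, hy, rfl⟩
      exact ⟨y, ⟨hy, y.2⟩, (tau_simple y).symm⟩
    · rintro ⟨i, ⟨hiX, hiY⟩, rfl⟩
      exact ⟨⟨i, hiY⟩, hiX, tau_simple ⟨i, hiY⟩⟩
  have hY : tau M Y r ∈ parabolic M Y := by
    rw [← range_tau]
    exact ⟨r, rfl⟩
  rw [← Subgroup.mem_map_iff_mem tau_injective, hmap, mem_parabolic_inter, and_iff_left hY]

theorem inclWord_piStarRel {Y : Set I} (h : X ⊆ Y) (ω : SignedWord Y) :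
    inclWord (piStarRel M h ω) = inclWord (piStar M X (inclWord ω)) := by
  classical
  have e : inclWord (piStarRel M h ω) =
      inclWord (inclWord (piStar (restrict M Y) {y : Y | (y : I) ∈ X} ω)) := by
    simp [inclWord, piStarRel]
  apply signedReflections_injective (M := M)
  rw [e, signedReflections_inclWord, isRetractedWord_piStar, isRetractedWord_piStar,
    signedReflections_inclWord, List.filter_map]
  congr 1
  refine List.filter_congr fun p _ => ?_
  simp [tau_mem_parabolic_iff]

theorem inclWord_piStar_inter_left (Y : Set I) (ω : SignedWord Y) :
    inclWord (piStar M (Y ∩ X) (inclWord ω)) = inclWord (piStar M X (inclWord ω)) := by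
  classical
  apply signedReflections_injective (M := M)
  rw [isRetractedWord_piStar, isRetractedWord_piStar, signedReflections_inclWord]
  refine List.filter_congr fun p hp => ?_
  obtain ⟨r, -, rfl⟩ := List.mem_map.mp hp
  have hY : tau M Y r.1 ∈ parabolic M Y := by
    rw [← range_tau]
    exact ⟨r.1, rfl⟩
  simp [mem_parabolic_inter, hY]

theorem inclWord_piStar_piStar (Y : Set I) (ω : SignedWord I) :
    inclWord (piStar M Y (inclWord (piStar M X ω))) = inclWord (piStar M (X ∩ Y) ω) := by
  classical
  apply signedReflections_injective (M := M)
  rw [isRetractedWord_piStar, isRetractedWord_piStar, isRetractedWord_piStar, List.filter_filter]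
  refine List.filter_congr fun p _ => ?_
  simp [mem_parabolic_inter, Bool.and_comm]

/-! ### The induced map on Artin-Tits groups -/

variable (M X) in
/-- The map `π_{I,X} : A_I → A_X`: the component of `artinWreath` at the trivial coset. -/
noncomputable def artinRetraction (a : ArtinGroup M) : ArtinGroup (restrict M X) :=
  (artinWreath M X a).left 1

theorem artinRetraction_wordElt (ω : SignedWord I) :
    artinRetraction M X (wordElt M ω) = wordElt (restrict M X) (piStar M X ω) := by
  rw [artinRetraction, artinWreath_wordElt_left, piStar_eq_retract]

theorem artinRetraction_mul (a b : ArtinGroup M) :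
    artinRetraction M X (a * b) =
      artinRetraction M X a * (artinWreath M X b).left (theta M a) := by
  rw [artinRetraction, map_mul, SemidirectProduct.mul_left, Pi.mul_apply, translation_apply,
    artinWreath_right, one_mul]
  rfl

theorem artinWreath_left_of_mem {u : M.Group} (hu : u ∈ parabolic M X) (a : ArtinGroup M) :
    (artinWreath M X a).left u = artinRetraction M X a := by
  obtain ⟨ω, rfl⟩ := exists_wordElt a
  rw [artinRetraction, artinWreath_wordElt_left, artinWreath_wordElt_left,
    retract_congr (w := 1) (by simpa using hu)]

theorem artinRetraction_mul_of_mem {a : ArtinGroup M} (ha : theta M a ∈ parabolic M X)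
    (b : ArtinGroup M) :
    artinRetraction M X (a * b) = artinRetraction M X a * artinRetraction M X b := by
  rw [artinRetraction_mul, artinWreath_left_of_mem ha]

theorem theta_wordElt_mem_parabolic {ω : SignedWord I} (h : IsWordOn X ω) :
    theta M (wordElt M ω) ∈ parabolic M X := by
  rw [theta_wordElt]
  refine wordProd_mem_parabolic M X fun i hi => ?_
  obtain ⟨a, ha, rfl⟩ := List.mem_map.mp hi
  exact h a ha

theorem tau_theta_artinRetraction_mul (a : ArtinGroup M) :
    tau M X (theta (restrict M X) (artinRetraction M X a)) * minRep M X (theta M a) =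
      theta M a := by
  obtain ⟨ω, rfl⟩ := exists_wordElt a
  rw [artinRetraction_wordElt, tau_theta_wordElt, theta_wordElt, piStar_eq_retract]
  simpa [minRep_one] using wordProd_retract_mul_minRep (X := X) 1 ω

theorem artinRetraction_mem_coloredArtin {a : ArtinGroup M} (ha : a ∈ coloredArtin M) :
    artinRetraction M X a ∈ coloredArtin (restrict M X) := by
  have h := tau_theta_artinRetraction_mul (X := X) a
  rw [MonoidHom.mem_ker.mp ha, minRep_one, mul_one] at h
  exact MonoidHom.mem_ker.mpr (tau_injective (h.trans (map_one _).symm))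

variable (M X) in
/-- The restriction of `artinRetraction` to the colored Artin-Tits groups. -/
noncomputable def coloredRetraction : coloredArtin M →* coloredArtin (restrict M X) where
  toFun a := ⟨artinRetraction M X a, artinRetraction_mem_coloredArtin a.2⟩
  map_one' := Subtype.ext <| by
    simp [artinRetraction]
  map_mul' a b := Subtype.ext <| artinRetraction_mul_of_mem
    (by rw [MonoidHom.mem_ker.mp a.2]; exact one_mem _) b

theorem IsMinimal.isDoubleReduced {v : M.Group} (hv : IsMinimal M X v) :
    IsDoubleReduced M X ∅ v := by
  intro w hw
  obtain ⟨u, hu, e, he, rfl⟩ := DoubleCoset.mem_doubleCoset.mp hw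
  have he1 : e = 1 := by simpa [parabolic] using he
  rw [he1, mul_one]
  exact hv u hu

/-! ### Positive elements -/

theorem mem_positiveMonoid_iff {B : Type*} {N : CoxeterMatrix B} {a : ArtinGroup N} :
    a ∈ positiveMonoid N ↔ ∃ ω : SignedWord B, (∀ x ∈ ω, x.2 = true) ∧ wordElt N ω = a := by
  have hcons : ∀ (b : B) (ω : SignedWord B),
      wordElt N ((b, true) :: ω) = artinGen N b * wordElt N ω := fun b ω => by
    rw [artinGen, PresentedGroup.of, FreeGroup.of, wordElt, wordElt, ← map_mul, FreeGroup.mul_mk]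
    rfl
  constructor
  · intro h
    induction h using Submonoid.closure_induction_left with
    | one => exact ⟨[], by simp, rfl⟩
    | mul_left x hx y _ ih =>
      obtain ⟨b, rfl⟩ := hx
      obtain ⟨ω, hω, rfl⟩ := ih
      exact ⟨(b, true) :: ω, by simpa using hω, hcons b ω⟩
  · rintro ⟨ω, hω, rfl⟩
    induction ω with
    | nil => exact one_mem _
    | cons x ω ih =>
      obtain ⟨b, ε⟩ := x
      obtain rfl : ε = true := hω (b, ε) (by simp)
      rw [hcons]
      exact mul_mem (Submonoid.subset_closure ⟨b, rfl⟩) (ih fun y hy => hω y (by simp [hy]))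

theorem retract_positive {w : M.Group} {ω : SignedWord I} (hω : ∀ x ∈ ω, x.2 = true) :
    ∀ x ∈ retract M X w ω, x.2 = true := by
  induction ω generalizing w with
  | nil => simp [retract]
  | cons a ω ih =>
    intro x hx
    rw [retract, List.mem_append] at hx
    rcases hx with hx | hx
    · obtain ⟨q, -, rfl⟩ := List.mem_map.mp hx
      exact hω a (by simp)
    · exact ih (fun y hy => hω y (by simp [hy])) x hx

theorem piStar_inclWord (ω : SignedWord X) : piStar M X (inclWord ω) = ω := by
  rw [piStar_eq_retract, retract_inclWord (one_mem _)]

theorem image_positiveMonoid :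
    artinRetraction M X '' (positiveMonoid M : Set (ArtinGroup M)) =
      (positiveMonoid (restrict M X) : Set (ArtinGroup (restrict M X))) := by
  ext b
  constructor
  · rintro ⟨a, ha, rfl⟩
    obtain ⟨ω, hω, rfl⟩ := mem_positiveMonoid_iff.mp ha
    rw [artinRetraction_wordElt, piStar_eq_retract]
    exact mem_positiveMonoid_iff.mpr ⟨_, retract_positive hω, rfl⟩
  · intro hb
    obtain ⟨ω, hω, rfl⟩ := mem_positiveMonoid_iff.mp hb
    refine ⟨wordElt M (inclWord ω), mem_positiveMonoid_iff.mpr ⟨_, ?_, rfl⟩, ?_⟩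
    · intro x hx
      obtain ⟨y, hy, rfl⟩ := List.mem_map.mp hx
      exact hω y hy
    · rw [artinRetraction_wordElt, piStar_inclWord]

end ArtinTits

theorem proposition1 {I : Type*} (M : CoxeterMatrix I) (X : Set I) :
    -- the word map is well defined by its construction
    (∀ ω : ArtinTits.SignedWord I,
      ArtinTits.IsRetractedWord M X ω (ArtinTits.piStar M X ω) ∧
      ∀ ω' : ArtinTits.SignedWord X, ArtinTits.IsRetractedWord M X ω ω' →
        ω' = ArtinTits.piStar M X ω) ∧
    -- lengths, and words on `Σ_X ∪ Σ_X⁻¹`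
    (∀ ω : ArtinTits.SignedWord I,
      (ArtinTits.piStar M X ω).length ≤ ω.length ∧
      ((ArtinTits.piStar M X ω).length = ω.length ↔ ArtinTits.IsWordOn X ω) ∧
      (ArtinTits.IsWordOn X ω → ArtinTits.inclWord (ArtinTits.piStar M X ω) = ω)) ∧
    -- prefixes
    (∀ ω ω' : ArtinTits.SignedWord I,
      ArtinTits.piStar M X ω <+: ArtinTits.piStar M X (ω ++ ω')) ∧
    -- the induced map `π : A_I → A_X` and its properties
    (∃ π : ArtinTits.ArtinGroup M → ArtinTits.ArtinGroup (ArtinTits.restrict M X),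
      (∀ ω : ArtinTits.SignedWord I,
        π (ArtinTits.wordElt M ω) =
          ArtinTits.wordElt (ArtinTits.restrict M X) (ArtinTits.piStar M X ω)) ∧
      -- decomposition in the Coxeter group
      (∀ (a : ArtinTits.ArtinGroup M) (v : M.Group),
        v = ArtinTits.tau M X (ArtinTits.theta (ArtinTits.restrict M X) (π a)) →
        ArtinTits.IsDoubleReduced M X ∅ (v⁻¹ * ArtinTits.theta M a) ∧
        ArtinTits.coxLength M (ArtinTits.theta M a) =
          ArtinTits.coxLength M v + ArtinTits.coxLength M (v⁻¹ * ArtinTits.theta M a)) ∧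
      -- restriction to colored Artin-Tits groups
      (∃ f : ArtinTits.coloredArtin M →*
            ArtinTits.coloredArtin (ArtinTits.restrict M X),
        ∀ a : ArtinTits.coloredArtin M,
          (f a : ArtinTits.ArtinGroup (ArtinTits.restrict M X)) =
            π (a : ArtinTits.ArtinGroup M)) ∧
      -- positive monoids
      π '' (ArtinTits.positiveMonoid M : Set (ArtinTits.ArtinGroup M)) =
        (ArtinTits.positiveMonoid (ArtinTits.restrict M X) :
          Set (ArtinTits.ArtinGroup (ArtinTits.restrict M X))) ∧
      -- left factor represented by a word on `Σ_X ∪ Σ_X⁻¹`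
      (∀ (ω : ArtinTits.SignedWord I) (a : ArtinTits.ArtinGroup M), ArtinTits.IsWordOn X ω →
        π (ArtinTits.wordElt M ω * a) = π (ArtinTits.wordElt M ω) * π a) ∧
      -- left factor in the colored Artin-Tits group
      (∀ c ∈ ArtinTits.coloredArtin M, ∀ a : ArtinTits.ArtinGroup M,
        π (c * a) = π c * π a)) ∧
    -- words on `Σ_Y ∪ Σ_Y⁻¹`
    (∀ (Y : Set I) (ω : ArtinTits.SignedWord Y),
      ArtinTits.IsWordOn (Y ∩ X)
        (ArtinTits.inclWord (ArtinTits.piStar M X (ArtinTits.inclWord ω))) ∧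
      ArtinTits.inclWord (ArtinTits.piStar M X (ArtinTits.inclWord ω)) =
        ArtinTits.inclWord
          (ArtinTits.piStarRel M (X := Y ∩ X) (Y := Y) Set.inter_subset_left ω)) ∧
    -- intersections
    (∀ (Y : Set I) (ω : ArtinTits.SignedWord I),
      ArtinTits.inclWord
          (ArtinTits.piStar M Y (ArtinTits.inclWord (ArtinTits.piStar M X ω))) =
        ArtinTits.inclWord (ArtinTits.piStar M (X ∩ Y) ω) ∧
      ArtinTits.inclWord
          (ArtinTits.piStar M X (ArtinTits.inclWord (ArtinTits.piStar M Y ω))) =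
        ArtinTits.inclWord (ArtinTits.piStar M (X ∩ Y) ω)) ∧
    -- compositions
    (∀ (Y : Set I) (h : X ⊆ Y) (ω : ArtinTits.SignedWord I),
      ArtinTits.piStarRel M h (ArtinTits.piStar M Y ω) = ArtinTits.piStar M X ω) := by
  refine ⟨fun ω => ⟨ArtinTits.isRetractedWord_piStar ω,
      fun ω' h => h.unique (ArtinTits.isRetractedWord_piStar ω)⟩, fun ω => ?_, fun ω ω' => ?_,
    ⟨ArtinTits.artinRetraction M X, ArtinTits.artinRetraction_wordElt, ?_,
      ⟨ArtinTits.coloredRetraction M X, fun _ => rfl⟩, ArtinTits.image_positiveMonoid, ?_, ?_⟩,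
    fun Y ω => ?_, fun Y ω => ?_, fun Y h ω => ?_⟩
  · have hincl : ArtinTits.IsWordOn X ω → ArtinTits.inclWord (ArtinTits.piStar M X ω) = ω := by
      intro h
      obtain ⟨ν, rfl⟩ := h.exists_inclWord
      rw [ArtinTits.piStar_inclWord]
    refine ⟨?_, ⟨fun h => ?_, fun h => ?_⟩, hincl⟩
    · rw [ArtinTits.piStar_eq_retract]
      exact ArtinTits.length_retract_le 1 ω
    · rw [ArtinTits.piStar_eq_retract] at h
      exact ArtinTits.isWordOn_of_length_retract (one_mem _) h
    · conv_rhs => rw [← hincl h, ArtinTits.inclWord, List.length_map]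
  · rw [ArtinTits.piStar_eq_retract, ArtinTits.piStar_eq_retract, ArtinTits.retract_append]
    exact List.prefix_append _ _
  · rintro a v rfl
    have h := ArtinTits.tau_theta_artinRetraction_mul (X := X) a
    have hmin := ArtinTits.minRep_isMinimal M X (ArtinTits.theta M a)
    have hv : ArtinTits.tau M X (ArtinTits.theta (ArtinTits.restrict M X)
        (ArtinTits.artinRetraction M X a)) ∈ ArtinTits.parabolic M X := by
      rw [← ArtinTits.range_tau]
      exact ⟨_, rfl⟩
    rw [inv_mul_eq_of_eq_mul h.symm]
    refine ⟨hmin.isDoubleReduced, ?_⟩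
    rw [← hmin.length_mul hv, h]
  · intro ω a hω
    exact ArtinTits.artinRetraction_mul_of_mem (ArtinTits.theta_wordElt_mem_parabolic hω) a
  · intro c hc a
    refine ArtinTits.artinRetraction_mul_of_mem ?_ a
    rw [MonoidHom.mem_ker.mp hc]
    exact one_mem _
  · rw [ArtinTits.inclWord_piStarRel, ArtinTits.inclWord_piStar_inter_left]
    refine ⟨?_, rfl⟩
    rw [← ArtinTits.inclWord_piStar_inter_left]
    exact ArtinTits.isWordOn_inclWord _
  · refine ⟨ArtinTits.inclWord_piStar_piStar Y ω, ?_⟩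
    rw [ArtinTits.inclWord_piStar_piStar, Set.inter_comm]
  · apply ArtinTits.inclWord_injective
    rw [ArtinTits.inclWord_piStarRel, ArtinTits.inclWord_piStar_piStar,
      Set.inter_eq_self_of_subset_right h]
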